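/- Let $0<\tau<T$, $s\in(1,2)$, and $0<R'<\tau$ with $R'\le T-\tau$. Let $\phi_s:\mathbb R\to[0,1]$ be the step function with $\phi_s(t)=1$ for $t\le 0$, $\phi_s(t)=0$ for $t\ge 1$ and $\phi_s(t)=\dfrac{e^{-(1-t)^{-\kappa}}}{e^{-(1-t)^{-\kappa}}+e^{-t^{-\kappa}}}$ for $0<t<1$, where $\kappa=(s-1)^{-1}$. For $\theta_0\in L^2(0,1)$ with cosine expansion $\theta_0(x)=\sum_{n\ge0}c_n\sqrt2\cos(n\pi x)$ in $L^2(0,1)$, put $$y_k=\sqrt2\Bigl(\sum_{n\ge0}c_ne^{-n^2\pi^2\tau}n^{2k}\Bigr)(-\pi^2)^k,\qquad y(t)=\phi_s\Bigl(\frac{t-\tau}{R'}\Bigr)\sum_{k\ge0}y_k\frac{(t-\tau)^k}{k!}$$ (so that $y(t)=0$ for $t\ge\tau+R'$), $$\theta(t,x)=\sum_{n\ge0}c_ne^{-n^2\pi^2t}\sqrt2\cos(n\pi x)\quad(0<t<\tau),\qquad \theta(t,x)=\sum_{i\ge0}y^{(i)}(t)\frac{x^{2i}}{(2i)!}\quad(\tau\le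 t\le T),$$ and $u(t)=0$ for $t\le\tau$, $u(t)=\sum_{i\ge1}\frac{y^{(i)}(t)}{(2i-1)!}$ for $\tau<t\le T$. The series for $y_k$ ($k\ge0$), the series in $y$ for $t\in[\tau,\tau+R']$, and the series $\sum_{i\ge1}\frac{y^{(i)}(t)}{(2i-1)!}$ and $\sum_{i\ge0}y^{(i)}(t)\frac{x^{2i}}{(2i)!}$ for $t\in[\tau,T]$, $x\in[0,1]$, all converge; $y$ is $C^\infty$ at every point of $[\tau,T]$; and $\theta$ is a classical solution of $\theta_t=\theta_{xx}$ on $(0,T]\times[0,1]$ with $\theta_x(t,0)=0$, $\theta_x(t,1)=u(t)$, and $\theta(t,\cdot)\to\theta_0$ in $L^2(0,1)$ as $t\to0^+$. For $\bar\imath,\bar k,\bar n\in\mathbb N$ define the truncations $$\overline{y_k}=\sqrt2\Bigl(\sum_{0\le n\le\bar n}c_ne^{-n^2\pi^2\tau}n^{2k}\Bigr)(-\pi^2)^k,\quad \overline y(t)=\phi_s\Bigl(\frac{t-\tau}{R'}\Bigr)\sum_{0\le k\le\bar k}\overline{y_k}\frac{(t-\tau)^k}{k!},\quad \overline\theta(t,x)=\sum_{0\le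 i\le\bar\imath}\overline y^{(i)}(t)\frac{x^{2i}}{(2i)!}.$$ Then there exist positive constants $C,C_1,C_2,C_3$, depending only on $T,\tau,s,R'$, such that for all $\theta_0\in L^2(0,1)$, all $\bar\imath,\bar k,\bar n\in\mathbb N$ and all $t\in[\tau,T]$, $$\|\theta(t)-\overline\theta(t)\|_{L^\infty(0,1)}\le C\left(e^{-C_1\bar\imath\ln\bar\imath}+e^{-C_2\bar k}+e^{-C_3\bar n^2}\right)\|\theta_0\|_{L^2(0,1)},$$ where $0\ln 0=0$. -/

import Mathlib

open MeasureTheory Filter Topology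

noncomputable section

namespace FlatHeat

/-- Lebesgue measure on the unit interval `(0,1)`. -/
abbrev unitMeasure : Measure ℝ := volume.restrict (Set.Ioo (0 : ℝ) 1)

/-- The space `L²(0,1)` of real functions, with its usual norm. -/
abbrev L2 : Type := Lp ℝ 2 unitMeasure

/-- The step function `φ_s`, with exponent `k = (s-1)⁻¹`. -/
def stepFn (s t : ℝ) : ℝ :=
  if t ≤ 0 then 1
  else if 1 ≤ t then 0
  else Real.exp (-(1 - t) ^ (-(s - 1)⁻¹)) /
    (Real.exp (-(1 - t) ^ (-(s - 1)⁻¹)) + Real.exp (-t ^ (-(s - 1)⁻¹)))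

/-- The coefficients of the expansion `θ₀ = ∑_{n ≥ 0} c_n √2 cos(nπx)` in `L²(0,1)`. As the functions
`√2 cos(nπx)`, `n ≥ 1`, have norm `1` and the constant `√2` has norm `√2`, the coefficient `c_0`
carries an additional factor `1/2`. -/
def cosCoeff (θ₀ : L2) (n : ℕ) : ℝ :=
  (if n = 0 then 1 / 2 else 1) *
    ∫ x, θ₀ x * (Real.sqrt 2 * Real.cos (n * Real.pi * x)) ∂unitMeasure

/-- The `n`-th term of the series for `y_k`, without the factor `√2 (-π²)^k`:
`c_n e^{-n²π²τ} n^{2k}`. -/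
def yTerm (τ : ℝ) (θ₀ : L2) (k n : ℕ) : ℝ :=
  cosCoeff θ₀ n * Real.exp (-(n : ℝ) ^ 2 * Real.pi ^ 2 * τ) * (n : ℝ) ^ (2 * k)

/-- `y_k = √2 (∑_{n ≥ 0} c_n e^{-n²π²τ} n^{2k}) (-π²)^k`. -/
def yCoeff (τ : ℝ) (θ₀ : L2) (k : ℕ) : ℝ :=
  Real.sqrt 2 * (∑' n : ℕ, yTerm τ θ₀ k n) * (-Real.pi ^ 2) ^ k

/-- `y_k` with its series truncated at order `N`. -/
def yCoeffBar (τ : ℝ) (θ₀ : L2) (N k : ℕ) : ℝ :=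
  Real.sqrt 2 * (∑ n ∈ Finset.range (N + 1), yTerm τ θ₀ k n) * (-Real.pi ^ 2) ^ k

/-- The flat output `y(t) = φ_s((t-τ)/R') ∑_{k ≥ 0} y_k (t-τ)^k / k!`. The step function makes it
vanish for `t ≥ τ + R'`. -/
def flatOutput (τ R' s : ℝ) (θ₀ : L2) (t : ℝ) : ℝ :=
  stepFn s ((t - τ) / R') * ∑' k : ℕ, yCoeff τ θ₀ k * (t - τ) ^ k / (k.factorial : ℝ)

/-- The flat output with its series truncated at order `K` and each `y_k` replaced by its truncation
of order `N`. -/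
def flatOutputBar (τ R' s : ℝ) (θ₀ : L2) (K N : ℕ) (t : ℝ) : ℝ :=
  stepFn s ((t - τ) / R') *
    ∑ k ∈ Finset.range (K + 1), yCoeffBar τ θ₀ N k * (t - τ) ^ k / (k.factorial : ℝ)

/-- The control: `0` up to time `τ`, and `∑_{i ≥ 1} y^{(i)}(t) / (2i-1)!` afterwards (the summation
index is shifted by one). -/
def control (τ R' s : ℝ) (θ₀ : L2) (t : ℝ) : ℝ :=
  if t ≤ τ then 0
  else ∑' i : ℕ, iteratedDeriv (i + 1) (flatOutput τ R' s θ₀) t / ((2 * i + 1).factorial : ℝ)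

/-- The temperature: `∑_{n ≥ 0} c_n e^{-n²π²t} √2 cos(nπx)` before time `τ` (zero control), and
`∑_{i ≥ 0} y^{(i)}(t) x^{2i} / (2i)!` from time `τ` on. -/
def theta (τ R' s : ℝ) (θ₀ : L2) (t x : ℝ) : ℝ :=
  if t < τ then
    ∑' n : ℕ, cosCoeff θ₀ n * Real.exp (-(n : ℝ) ^ 2 * Real.pi ^ 2 * t) *
      (Real.sqrt 2 * Real.cos (n * Real.pi * x))
  else ∑' i : ℕ, iteratedDeriv i (flatOutput τ R' s θ₀) t * x ^ (2 * i) / ((2 * i).factorial : ℝ)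

/-- The approximate temperature: the series for `θ` truncated at order `I`, built on the truncated
flat output. -/
def thetaBar (τ R' s : ℝ) (θ₀ : L2) (I K N : ℕ) (t x : ℝ) : ℝ :=
  ∑ i ∈ Finset.range (I + 1),
    iteratedDeriv i (flatOutputBar τ R' s θ₀ K N) t * x ^ (2 * i) / ((2 * i).factorial : ℝ)

/-- `θ` is a classical solution of the heat equation `θ_t = θ_xx` on `(0,T] × [0,1]`, with
`θ_x(t,0) = 0`, `θ_x(t,1) = u(t)` and initial state `θ₀ ∈ L²(0,1)`: the functions `θ`, `θ_x`,
`θ_xx = θ_t` exist and are continuous on `(0,T] × [0,1]`, and `θ(t,·) → θ₀` in `L²(0,1)` as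
`t → 0⁺`. -/
def IsHeatSolution (T : ℝ) (θ₀ : L2) (u : ℝ → ℝ) (θ : ℝ → ℝ → ℝ) : Prop :=
  (∃ θx θxx : ℝ → ℝ → ℝ,
    ContinuousOn (Function.uncurry θ) (Set.Ioc 0 T ×ˢ Set.Icc 0 1) ∧
    ContinuousOn (Function.uncurry θx) (Set.Ioc 0 T ×ˢ Set.Icc 0 1) ∧
    ContinuousOn (Function.uncurry θxx) (Set.Ioc 0 T ×ˢ Set.Icc 0 1) ∧
    ∀ t ∈ Set.Ioc 0 T,
      (∀ x ∈ Set.Icc (0 : ℝ) 1,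
        HasDerivWithinAt (θ t) (θx t x) (Set.Icc 0 1) x ∧
        HasDerivWithinAt (θx t) (θxx t x) (Set.Icc 0 1) x ∧
        HasDerivWithinAt (fun r => θ r x) (θxx t x) (Set.Ioc 0 T) t) ∧
      θx t 0 = 0 ∧ θx t 1 = u t) ∧
  Tendsto (fun t => eLpNorm (fun x => θ t x - θ₀ x) 2 unitMeasure) (𝓝[>] 0) (𝓝 0)

/-- All series that enter `y`, `u` and `θ` on `[τ,T]` converge, and `y` is smooth there. -/
def SeriesConverge (T τ R' s : ℝ) (θ₀ : L2) : Prop :=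
  (∀ k : ℕ, Summable (yTerm τ θ₀ k)) ∧
  (∀ t ∈ Set.Icc τ (τ + R'),
    Summable fun k : ℕ => yCoeff τ θ₀ k * (t - τ) ^ k / (k.factorial : ℝ)) ∧
  (∀ t ∈ Set.Icc τ T, ContDiffAt ℝ (⊤ : ℕ∞) (flatOutput τ R' s θ₀) t) ∧
  (∀ t ∈ Set.Icc τ T,
    Summable fun i : ℕ =>
      iteratedDeriv (i + 1) (flatOutput τ R' s θ₀) t / ((2 * i + 1).factorial : ℝ)) ∧
  (∀ t ∈ Set.Icc τ T, ∀ x ∈ Set.Icc (0 : ℝ) 1,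
    Summable fun i : ℕ =>
      iteratedDeriv i (flatOutput τ R' s θ₀) t * x ^ (2 * i) / ((2 * i).factorial : ℝ))

end FlatHeat

end

namespace FlatHeat

/-! Let `freeOutput` be the trace at x = 0 of the uncontrolled evolution, √2 ∑ c_n e^{-n²π²t}. It is
the restriction of a function holomorphic in Re z > 0, and the y_k are its derivatives at τ. As R' <
τ, its Taylor series at τ converges to it wherever the step function is nonzero and t > 0, so y =
φ_s((t-τ)/R') · `freeOutput` on t > 0 (`flatOutput_eq`).

The step function is Gevrey of order s (`exists_gevrey_stepFn`): 1-φ_s extends holomorphically to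
discs about t of radius proportional to t, with size e^{-t^{-κ}/2}. Cauchy's estimate then loses
t^{-n}, which the exponential beats at the price of n!^{s-1}. A product with an analytic factor
stays Gevrey (`gevrey_mul`), whence |y^{(i)}| ≤ M ρ^i i!^s ‖θ₀‖. Since (2i)! ≥ i!² and s < 2, the
series ∑ y^{(i)} x^{2i}/(2i)! and its derivatives converge normally for |x| ≤ 2, locally uniformly
in t > 0, and termwise differentiation gives the heat equation. For t ≤ τ this series is the cosine
series (`hasSum_freeOutput_cos`), so one formula describes θ for all t > 0 and nothing has to be
glued at τ. The initial condition is Parseval in the cosine basis with dominated convergence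
(`tendsto_freeState`).

For the truncation error, the tail i > I of the series for y is controlled by the Gevrey bound alone
(`exists_tail_gevreyWeight`). In the terms i ≤ I, the error of the flat output is the step function
times the real part of a holomorphic function, small on a disc about τ of radius between R' and τ:
cutting n costs a Gaussian tail, cutting k costs the Taylor remainder of the exponential
(`norm_expSum_sub_truncSum_le`). Cauchy's estimate and `gevrey_mul` carry that smallness to all
derivatives (`exists_gevrey_flatOutput_sub`). -/

/-! ### Real functions that are real parts of holomorphic functions -/

theorem differentiableOn_iteratedDeriv {U : Set ℂ} (hU : IsOpen U) {F : ℂ → ℂ}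
    (hF : DifferentiableOn ℂ F U) (n : ℕ) : DifferentiableOn ℂ (iteratedDeriv n F) U := by
  induction n with
  | zero => simpa using hF
  | succ n ih => rw [iteratedDeriv_succ]; exact ih.deriv hU

/-- Iterated derivatives of the real part of a holomorphic function along the real axis. -/
theorem iteratedDeriv_re_of_holomorphic {U : Set ℂ} (hU : IsOpen U) {F : ℂ → ℂ}
    (hF : DifferentiableOn ℂ F U) {f : ℝ → ℝ} (hf : ∀ x : ℝ, (x : ℂ) ∈ U → f x = (F x).re)
    (n : ℕ) {x : ℝ} (hx : (x : ℂ) ∈ U) : iteratedDeriv n f x = (iteratedDeriv n F x).re := by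
  induction n generalizing x with
  | zero => simpa using hf x hx
  | succ n ih =>
    have hd := ((differentiableOn_iteratedDeriv hU hF n).differentiableAt
      (hU.mem_nhds hx)).hasDerivAt.real_of_complex
    rw [iteratedDeriv_succ, iteratedDeriv_succ, ← hd.deriv]
    apply Filter.EventuallyEq.deriv_eq
    filter_upwards [(hU.preimage Complex.continuous_ofReal).mem_nhds hx] with y hy
    exact ih hy

theorem differentiableAt_iteratedDeriv_of_holomorphic {U : Set ℂ} (hU : IsOpen U) {F : ℂ → ℂ}
    (hF : DifferentiableOn ℂ F U) {f : ℝ → ℝ} (hf : ∀ x : ℝ, (x : ℂ) ∈ U → f x = (F x).re)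
    (n : ℕ) {x : ℝ} (hx : (x : ℂ) ∈ U) : DifferentiableAt ℝ (iteratedDeriv n f) x := by
  have hd := ((differentiableOn_iteratedDeriv hU hF n).differentiableAt
      (hU.mem_nhds hx)).hasDerivAt.real_of_complex
  refine (hd.congr_of_eventuallyEq ?_).differentiableAt
  filter_upwards [(hU.preimage Complex.continuous_ofReal).mem_nhds hx] with y hy
  exact iteratedDeriv_re_of_holomorphic hU hF hf n hy

theorem contDiffAt_of_holomorphic {U : Set ℂ} (hU : IsOpen U) {F : ℂ → ℂ}
    (hF : DifferentiableOn ℂ F U) {f : ℝ → ℝ} (hf : ∀ x : ℝ, (x : ℂ) ∈ U → f x = (F x).re)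
    {n : WithTop ℕ∞} {x : ℝ} (hx : (x : ℂ) ∈ U) : ContDiffAt ℝ n f x := by
  have h : ContDiffAt ℝ n (fun x : ℝ => (F x).re) x :=
    ((hF.contDiffOn hU).contDiffAt (hU.mem_nhds hx)).real_of_complex
  refine h.congr_of_eventuallyEq ?_
  filter_upwards [(hU.preimage Complex.continuous_ofReal).mem_nhds hx] with y hy
  exact hf y hy

/-- Cauchy's estimate for the real part of a holomorphic function along the real axis. -/
theorem abs_iteratedDeriv_le_of_holomorphic {U : Set ℂ} (hU : IsOpen U) {F : ℂ → ℂ}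
    (hF : DifferentiableOn ℂ F U) {f : ℝ → ℝ} (hf : ∀ x : ℝ, (x : ℂ) ∈ U → f x = (F x).re)
    {x r M : ℝ} (hr : 0 < r) (hball : Metric.closedBall (x : ℂ) r ⊆ U)
    (hM : ∀ z ∈ Metric.closedBall (x : ℂ) r, ‖F z‖ ≤ M) (n : ℕ) :
    |iteratedDeriv n f x| ≤ n.factorial * M / r ^ n := by
  rw [iteratedDeriv_re_of_holomorphic hU hF hf n (hball (Metric.mem_closedBall_self hr.le))]
  refine (Complex.abs_re_le_norm _).trans
    (Complex.norm_iteratedDeriv_le_of_forall_mem_sphere_norm_le n hr ?_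
      fun z hz => hM z (Metric.sphere_subset_closedBall hz))
  refine DifferentiableOn.diffContOnCl ?_
  rw [closure_ball _ hr.ne']
  exact hF.mono hball

/-! ### The step function -/

/-- The complement `1 - φ_s` of the step function. -/
noncomputable def costep (s t : ℝ) : ℝ := 1 - stepFn s t

theorem costep_of_nonpos {s t : ℝ} (ht : t ≤ 0) : costep s t = 0 := by
  simp [costep, stepFn, ht]

theorem stepFn_of_one_le {s t : ℝ} (ht : 1 ≤ t) : stepFn s t = 0 := by
  have : ¬ t ≤ 0 := by linarith
  simp [stepFn, ht, this]

theorem stepFn_of_nonpos {s t : ℝ} (ht : t ≤ 0) : stepFn s t = 1 := by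
  simp [stepFn, ht]

/-- This symmetry reduces all estimates to t ≤ 1/2, where only the flat point 0 matters. -/
theorem stepFn_one_sub (s t : ℝ) : stepFn s (1 - t) = costep s t := by
  unfold costep stepFn
  rcases le_or_gt t 0 with h | h
  · have h1 : ¬ (1 - t ≤ 0) := by linarith
    simp [h, h1]
  rcases le_or_gt 1 t with h' | h'
  · have h1 : ¬ (t ≤ 0) := by linarith
    simp [h', h1]
  have h1 : ¬ (1 - t ≤ 0) := by linarith
  have h2 : ¬ (1 ≤ 1 - t) := by linarith
  have h3 : ¬ (t ≤ 0) := by linarith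
  have h4 : ¬ (1 ≤ t) := by linarith
  simp only [h1, h2, h3, h4, if_false, sub_sub_cancel]
  have := Real.exp_pos (-(1 - t) ^ (-(s - 1)⁻¹))
  have := Real.exp_pos (-t ^ (-(s - 1)⁻¹))
  field_simp
  ring

/-- The holomorphic extension of `1 - φ_s` to the strip `0 < Re z < 1`, away from poles. -/
noncomputable def costepExt (κ : ℝ) (z : ℂ) : ℂ :=
  (1 + Complex.exp (z ^ (-κ : ℂ) - (1 - z) ^ (-κ : ℂ)))⁻¹

theorem costep_eq_costepExt {s t : ℝ} (h0 : 0 < t) (h1 : t < 1) :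
    costep s t = (costepExt (s - 1)⁻¹ t).re := by
  have e : costepExt (s - 1)⁻¹ t =
      (((1 + Real.exp (t ^ (-(s - 1)⁻¹) - (1 - t) ^ (-(s - 1)⁻¹)))⁻¹ : ℝ) : ℂ) := by
    unfold costepExt
    push_cast [Complex.ofReal_cpow h0.le, Complex.ofReal_cpow (sub_nonneg.2 h1.le)]
    rfl
  rw [e, Complex.ofReal_re]
  have h3 : ¬ (t ≤ 0) := by linarith
  have h4 : ¬ (1 ≤ t) := by linarith
  simp only [costep, stepFn, h3, h4, if_false, Real.exp_sub, Real.exp_neg]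
  have := Real.exp_pos ((1 - t) ^ (-(s - 1)⁻¹))
  have := Real.exp_pos (t ^ (-(s - 1)⁻¹))
  field_simp
  ring

/-- Homogeneity: z^{-κ} = t^{-κ} (z/t)^{-κ}, so continuity of w^{-κ} at w = 1 gives a relative error
that is uniform in t. -/
theorem exists_cpow_near_one (κ : ℝ) {ε : ℝ} (hε : 0 < ε) : ∃ c : ℝ, 0 < c ∧ c ≤ 1 / 4 ∧
    ∀ (t : ℝ) (z : ℂ), 0 < t → ‖z - t‖ ≤ c * t →
      ‖z ^ (-κ : ℂ) - (t ^ (-κ) : ℝ)‖ ≤ ε * t ^ (-κ) := by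
  have hc : ContinuousAt (fun w : ℂ => w ^ (-κ : ℂ)) 1 :=
    continuousAt_cpow_const (by simp [Complex.slitPlane])
  obtain ⟨δ, hδ, h⟩ := Metric.continuousAt_iff.1 hc ε hε
  refine ⟨min (δ / 2) (1 / 4), by positivity, min_le_right _ _, fun t z ht hz => ?_⟩
  have htc : (t : ℂ) ≠ 0 := by exact_mod_cast ht.ne'
  set w : ℂ := z / t with hw
  have hzw : z = t * w := by rw [hw]; field_simp
  have hw1 : ‖w - 1‖ ≤ min (δ / 2) (1 / 4) := by
    have : w - 1 = (z - t) / t := by rw [hw]; field_simp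
    rw [this, norm_div, Complex.norm_real, Real.norm_of_nonneg ht.le, div_le_iff₀ ht]
    exact hz
  have hw0 : w ≠ 0 := by
    rintro h0
    rw [h0] at hw1
    have := hw1.trans (min_le_right _ _)
    norm_num at this
  have key : z ^ (-κ : ℂ) = (t ^ (-κ) : ℝ) * w ^ (-κ : ℂ) := by
    rw [Complex.cpow_def_of_ne_zero (by rw [hzw]; exact mul_ne_zero htc hw0), hzw,
      Complex.log_ofReal_mul ht hw0, add_mul, Complex.exp_add,
      Complex.cpow_def_of_ne_zero hw0, Real.rpow_def_of_pos ht]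
    push_cast
    rfl
  have hd := @h w (by rw [dist_eq_norm]; exact (hw1.trans (min_le_left _ _)).trans_lt (by linarith))
  rw [dist_eq_norm, Complex.one_cpow] at hd
  have : z ^ (-κ : ℂ) - (t ^ (-κ) : ℝ) = (t ^ (-κ) : ℝ) * (w ^ (-κ : ℂ) - 1) := by
    rw [key]; ring
  rw [this, norm_mul, Complex.norm_real, Real.norm_of_nonneg (by positivity), mul_comm]
  gcongr

/-- Bound of the holomorphic extension on discs of radius proportional to the distance to `0`. -/
theorem exists_costepExt_bound {κ : ℝ} (hκ : 1 ≤ κ) : ∃ c A : ℝ, 0 < c ∧ c ≤ 1 / 4 ∧ 0 < A ∧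
    ∀ (t : ℝ) (z : ℂ), 0 < t → t ≤ 1 / 2 → ‖z - t‖ ≤ c * t →
      1 + Complex.exp (z ^ (-κ : ℂ) - (1 - z) ^ (-κ : ℂ)) ≠ 0 ∧
      ‖costepExt κ z‖ ≤ A * Real.exp (-(t ^ (-κ) / 2)) := by
  -- P is t^{-κ} at the threshold t = 1/4. With relative error 1/(12P) on both powers, the exponent
  -- is off by at most p/(6P): at most p/6 always, and at most 1 once p ≤ P.
  set P : ℝ := 4 ^ κ with hP
  have hP1 : 1 ≤ P := Real.one_le_rpow (by norm_num) (by linarith)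
  obtain ⟨c, hc0, hc4, hc⟩ := exists_cpow_near_one κ (ε := 1 / (12 * P)) (by positivity)
  refine ⟨c, max 2 (Real.exp (P / 2)), hc0, hc4, by positivity, fun t z ht ht2 hz => ?_⟩
  set p : ℝ := t ^ (-κ) with hp
  set q : ℝ := (1 - t) ^ (-κ) with hq
  have hp0 : 0 < p := by positivity
  have hq0 : 0 ≤ q := Real.rpow_nonneg (by linarith) _
  have hqp : q ≤ p := Real.rpow_le_rpow_of_nonpos ht (by linarith) (by linarith)
  have e1 := hc t z ht hz
  have e2 := hc (1 - t) (1 - z) (by linarith) (by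
    have : (1 - z : ℂ) - ((1 - t : ℝ) : ℂ) = -(z - t) := by push_cast; ring
    rw [this, norm_neg]
    exact hz.trans (by gcongr; linarith))
  rw [← hp] at e1
  rw [← hq] at e2
  set h : ℂ := z ^ (-κ : ℂ) - (1 - z) ^ (-κ : ℂ) with hh
  have e3 : ‖h - ((p - q : ℝ) : ℂ)‖ ≤ p / (6 * P) := by
    have : h - ((p - q : ℝ) : ℂ) = (z ^ (-κ : ℂ) - (p : ℝ)) - ((1 - z) ^ (-κ : ℂ) - (q : ℝ)) := by
      rw [hh]; push_cast; ring
    rw [this]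
    refine (norm_sub_le _ _).trans ((add_le_add e1 e2).trans ?_)
    calc 1 / (12 * P) * p + 1 / (12 * P) * q ≤ 1 / (12 * P) * p + 1 / (12 * P) * p := by gcongr
      _ = p / (6 * P) := by field_simp; norm_num
  have hre : |h.re - (p - q)| ≤ p / (6 * P) := by
    simpa using (Complex.abs_re_le_norm _).trans e3
  have him : |h.im| ≤ p / (6 * P) := by
    simpa using (Complex.abs_im_le_norm _).trans e3
  have main : Real.exp (p / 2) ≤ max 2 (Real.exp (P / 2)) * ‖1 + Complex.exp h‖ := by
    -- For t ≤ 1/4, q ≤ p/3 gives Re h ≥ p - p/3 - p/6 = p/2, and e^{p/2} ≥ 2 absorbs the summand 1.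
    -- For t > 1/4, p is bounded and |Im h| ≤ 1, so Re e^h ≥ 0 and the denominator has modulus at
    -- least 1.
    rcases le_or_gt t (1 / 4) with h4 | h4
    · have hp4 : 4 ≤ p := by
        have h1 : (1 / 4 : ℝ) ^ (-κ) ≤ p := Real.rpow_le_rpow_of_nonpos ht h4 (by linarith)
        have h2 : (1 / 4 : ℝ) ^ (-κ) = P := by
          rw [one_div, Real.inv_rpow (by norm_num), Real.rpow_neg (by norm_num), inv_inv]
        have h3 : (4 : ℝ) ^ (1 : ℝ) ≤ P := Real.rpow_le_rpow_of_exponent_le (by norm_num) hκ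
        rw [Real.rpow_one] at h3
        linarith
      have hq3 : q ≤ p / 3 := by
        have h1 : q ≤ (3 * t) ^ (-κ) :=
          Real.rpow_le_rpow_of_nonpos (by positivity) (by linarith) (by linarith)
        rw [Real.mul_rpow (by norm_num) ht.le] at h1
        have h2 : (3 : ℝ) ^ (-κ) ≤ 3 ^ (-1 : ℝ) :=
          Real.rpow_le_rpow_of_exponent_le (by norm_num) (by linarith)
        rw [Real.rpow_neg_one] at h2
        calc q ≤ 3 ^ (-κ) * p := h1
          _ ≤ 3⁻¹ * p := by gcongr
          _ = p / 3 := by ring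
      have h6 : p / (6 * P) ≤ p / 6 := by
        apply div_le_div_of_nonneg_left hp0.le (by norm_num) (by linarith)
      have hre2 : p / 2 ≤ h.re := by
        have := (abs_le.1 hre).1
        linarith
      have hn : Real.exp (p / 2) - 1 ≤ ‖1 + Complex.exp h‖ := by
        have h7 : ‖Complex.exp h‖ - ‖(-1 : ℂ)‖ ≤ ‖Complex.exp h - (-1)‖ := norm_sub_norm_le _ _
        rw [Complex.norm_exp, norm_neg, norm_one, sub_neg_eq_add, add_comm (Complex.exp h)] at h7
        exact (sub_le_sub_right (Real.exp_le_exp.2 hre2) 1).trans h7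
      have h8 : 2 ≤ Real.exp (p / 2) := by
        have := Real.add_one_le_exp (p / 2)
        linarith
      calc Real.exp (p / 2) ≤ 2 * (Real.exp (p / 2) - 1) := by linarith
        _ ≤ max 2 (Real.exp (P / 2)) * ‖1 + Complex.exp h‖ := by
          gcongr
          · linarith
          · exact le_max_left _ _
    · have hpP : p ≤ P := by
        have h1 : p ≤ (1 / 4 : ℝ) ^ (-κ) :=
          Real.rpow_le_rpow_of_nonpos (by norm_num) h4.le (by linarith)
        rwa [one_div, Real.inv_rpow (by norm_num), Real.rpow_neg (by norm_num), inv_inv] at h1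
      have him1 : |h.im| ≤ 1 := by
        refine him.trans ?_
        rw [div_le_one (by positivity)]
        linarith
      have hcos : 0 ≤ Real.cos h.im :=
        Real.cos_nonneg_of_mem_Icc ⟨by linarith [(abs_le.1 him1).1, Real.pi_gt_three],
          by linarith [(abs_le.1 him1).2, Real.pi_gt_three]⟩
      have hn : 1 ≤ ‖1 + Complex.exp h‖ := by
        refine le_trans ?_ (Complex.re_le_norm _)
        rw [Complex.add_re, Complex.one_re, Complex.exp_re]
        have := mul_nonneg (Real.exp_pos h.re).le hcos
        linarith
      calc Real.exp (p / 2) ≤ Real.exp (P / 2) * 1 := by rw [mul_one]; gcongr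
        _ ≤ max 2 (Real.exp (P / 2)) * ‖1 + Complex.exp h‖ := by
          gcongr
          exact le_max_right _ _
  have hpos : 0 < ‖1 + Complex.exp h‖ := by
    have := (Real.exp_pos (p / 2)).trans_le main
    by_contra hcon
    have h0 : ‖1 + Complex.exp h‖ = 0 := le_antisymm (not_lt.1 hcon) (norm_nonneg _)
    rw [h0, mul_zero] at this
    exact lt_irrefl _ this
  refine ⟨norm_pos_iff.1 hpos, ?_⟩
  rw [costepExt, norm_inv, Real.exp_neg, ← hh]
  rw [inv_le_comm₀ hpos (by positivity), mul_inv, inv_inv]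
  rw [inv_mul_le_iff₀ (by positivity)]
  exact main

theorem costepExt_setup {s c t : ℝ} (hc0 : 0 < c) (hc : c ≤ 1 / 4) (ht : 0 < t) (ht2 : t ≤ 1 / 2)
    (hne : ∀ z : ℂ, ‖z - t‖ ≤ c * t →
      1 + Complex.exp (z ^ (-((s - 1)⁻¹ : ℝ) : ℂ) - (1 - z) ^ (-((s - 1)⁻¹ : ℝ) : ℂ)) ≠ 0) :
    DifferentiableOn ℂ (costepExt (s - 1)⁻¹) (Metric.ball (t : ℂ) (c * t)) ∧
    ∀ x : ℝ, (x : ℂ) ∈ Metric.ball (t : ℂ) (c * t) →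
      costep s x = (costepExt (s - 1)⁻¹ x).re := by
  constructor
  · intro z hz
    have hz' : ‖z - t‖ < c * t := by simpa [dist_eq_norm] using hz
    have hre : |z.re - t| < c * t := by
      simpa using (Complex.abs_re_le_norm (z - t)).trans_lt hz'
    have hct : c * t ≤ t / 4 := by nlinarith
    have h1 : z ∈ Complex.slitPlane := Or.inl (by linarith [(abs_lt.1 hre).1])
    have h2 : 1 - z ∈ Complex.slitPlane :=
      Or.inl (by simp only [Complex.sub_re, Complex.one_re]; linarith [(abs_lt.1 hre).2])
    refine DifferentiableAt.differentiableWithinAt ?_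
    unfold costepExt
    refine DifferentiableAt.inv ?_ (hne z hz'.le)
    refine (DifferentiableAt.cexp ?_).const_add 1
    exact (differentiableAt_id.cpow_const h1).sub
      (((differentiableAt_const 1).sub differentiableAt_id).cpow_const h2)
  · intro x hx
    have hx' : |x - t| < c * t := by
      have : ‖(x : ℂ) - t‖ < c * t := by simpa [dist_eq_norm] using hx
      rwa [← Complex.ofReal_sub, Complex.norm_real] at this
    have hct : c * t ≤ t / 4 := by nlinarith
    exact costep_eq_costepExt (by linarith [(abs_lt.1 hx').1]) (by linarith [(abs_lt.1 hx').2])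

theorem one_le_inv_sub_one {s : ℝ} (hs1 : 1 < s) (hs2 : s < 2) : 1 ≤ (s - 1)⁻¹ := by
  rw [one_le_inv₀ (by linarith)]
  linarith

theorem exists_iteratedDeriv_costep_near {s : ℝ} (hs1 : 1 < s) (hs2 : s < 2) :
    ∃ c A : ℝ, 0 < c ∧ 0 < A ∧ ∀ t : ℝ, 0 < t → t ≤ 1 / 2 → ∀ n : ℕ,
      DifferentiableAt ℝ (iteratedDeriv n (costep s)) t ∧
      |iteratedDeriv n (costep s) t| ≤
        n.factorial * (A * Real.exp (-(t ^ (-(s - 1)⁻¹) / 2))) / (c * t) ^ n := by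
  obtain ⟨c, A, hc0, hc4, hA, h⟩ := exists_costepExt_bound (one_le_inv_sub_one hs1 hs2)
  -- The radius is halved so that the closed disc lies in the open disc of holomorphy.
  refine ⟨c / 2, A, by positivity, hA, fun t ht ht2 n => ?_⟩
  obtain ⟨h1, h2⟩ := costepExt_setup (s := s) hc0 hc4 ht ht2 fun z hz => (h t z ht ht2 hz).1
  refine ⟨differentiableAt_iteratedDeriv_of_holomorphic Metric.isOpen_ball h1 h2 n
    (Metric.mem_ball_self (by positivity)), ?_⟩
  refine abs_iteratedDeriv_le_of_holomorphic Metric.isOpen_ball h1 h2 (by positivity)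
    (Metric.closedBall_subset_ball ?_) (fun z hz => (h t z ht ht2 ?_).2) n
  · gcongr; linarith
  · have : ‖z - t‖ ≤ c / 2 * t := by simpa [dist_eq_norm] using hz
    exact this.trans (by gcongr; linarith)

/-- With v = t^{-κ} one has v^{s-1} = 1/t. Raising (v/2)^n ≤ n! e^{v/2} to the power s-1 < 1 trades
t^{-n} for n!^{s-1}; with the n! of Cauchy's estimate this makes the Gevrey order s. -/
theorem inv_pow_mul_exp_le {s : ℝ} (hs1 : 1 < s) (hs2 : s < 2) {t : ℝ} (ht : 0 < t) (n : ℕ) :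
    Real.exp (-(t ^ (-(s - 1)⁻¹) / 2)) / t ^ n ≤ 2 ^ n * (n.factorial : ℝ) ^ (s - 1) := by
  set v : ℝ := t ^ (-(s - 1)⁻¹) with hv
  have hv0 : 0 < v := by positivity
  have hσ : 0 < s - 1 := by linarith
  have h1 : (v / 2) ^ n ≤ n.factorial * Real.exp (v / 2) := by
    have := Real.pow_div_factorial_le_exp (v / 2) (by positivity) n
    rwa [div_le_iff₀ (by positivity), mul_comm] at this
  have h2 : ((v / 2) ^ n) ^ (s - 1) ≤ (n.factorial : ℝ) ^ (s - 1) * Real.exp (v / 2) := by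
    calc ((v / 2) ^ n) ^ (s - 1) ≤ (n.factorial * Real.exp (v / 2)) ^ (s - 1) := by gcongr
      _ = (n.factorial : ℝ) ^ (s - 1) * Real.exp (v / 2) ^ (s - 1) :=
        Real.mul_rpow (by positivity) (by positivity)
      _ ≤ (n.factorial : ℝ) ^ (s - 1) * Real.exp (v / 2) := by
        gcongr
        conv_rhs => rw [← Real.rpow_one (Real.exp (v / 2))]
        exact Real.rpow_le_rpow_of_exponent_le (Real.one_le_exp (by positivity)) (by linarith)
  have h3 : v ^ (s - 1) = t⁻¹ := by
    rw [hv, ← Real.rpow_mul ht.le, neg_mul, inv_mul_cancel₀ hσ.ne', Real.rpow_neg_one]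
  have h4 : (t⁻¹ / 2) ^ n ≤ ((v / 2) ^ n) ^ (s - 1) := by
    rw [← Real.rpow_natCast (v / 2), ← Real.rpow_mul (by positivity), mul_comm,
      Real.rpow_mul (by positivity), Real.rpow_natCast, Real.div_rpow hv0.le (by norm_num), h3]
    gcongr
    conv_rhs => rw [← Real.rpow_one 2]
    exact Real.rpow_le_rpow_of_exponent_le (by norm_num) (by linarith)
  have h5 := h4.trans h2
  rw [div_pow, inv_pow, div_le_iff₀ (by positivity)] at h5
  rw [Real.exp_neg, div_eq_mul_inv, inv_mul_le_iff₀ (by positivity)]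
  linarith

theorem factorial_rpow_mul (s : ℝ) (n : ℕ) :
    (n.factorial : ℝ) * (n.factorial : ℝ) ^ (s - 1) = (n.factorial : ℝ) ^ s := by
  conv_rhs => rw [← add_sub_cancel 1 s, Real.rpow_add (by positivity), Real.rpow_one]

/-- Both claims advance together: if the n-th derivative vanishes at 0, the estimate with n+2 powers
of 1/t makes it O(t²), so it is differentiable there with derivative 0, which is the vanishing for
n+1. -/
theorem iteratedDeriv_costep_nonpos {s : ℝ} (hs1 : 1 < s) (hs2 : s < 2) (n : ℕ) :
    (∀ t ≤ 0, iteratedDeriv n (costep s) t = 0) ∧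
      HasDerivAt (iteratedDeriv n (costep s)) 0 0 := by
  obtain ⟨c, A, hc, hA, h⟩ := exists_iteratedDeriv_costep_near hs1 hs2
  have hneg : ∀ n : ℕ, ∀ t < 0, iteratedDeriv n (costep s) t = 0 := by
    intro n t ht
    have : costep s =ᶠ[𝓝 t] fun _ => 0 := by
      filter_upwards [Iio_mem_nhds ht] with x hx
      exact costep_of_nonpos (le_of_lt hx)
    rw [this.iteratedDeriv_eq]
    simp
  have hder : ∀ n : ℕ, iteratedDeriv n (costep s) 0 = 0 →
      HasDerivAt (iteratedDeriv n (costep s)) 0 0 := by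
    intro n h0
    set B : ℝ := n.factorial * A / c ^ n * (2 ^ (n + 2) * ((n + 2).factorial : ℝ) ^ (s - 1)) with hB
    have hbound : ∀ t ≤ 1 / 2, |iteratedDeriv n (costep s) t| ≤ B * t ^ 2 := by
      intro t ht2
      rcases lt_trichotomy t 0 with ht | ht | ht
      · rw [hneg n t ht, abs_zero]; positivity
      · rw [ht, h0, abs_zero]; positivity
      · refine ((h t ht ht2 n).2).trans ?_
        have := inv_pow_mul_exp_le hs1 hs2 ht (n + 2)
        calc n.factorial * (A * Real.exp (-(t ^ (-(s - 1)⁻¹) / 2))) / (c * t) ^ n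
            = n.factorial * A / c ^ n * (Real.exp (-(t ^ (-(s - 1)⁻¹) / 2)) / t ^ (n + 2)) *
              t ^ 2 := by
                rw [mul_pow, pow_add]; field_simp
          _ ≤ B * t ^ 2 := by rw [hB]; gcongr
    rw [hasDerivAt_iff_isLittleO]
    have hO : (fun t : ℝ => iteratedDeriv n (costep s) t) =O[𝓝 0] fun t => t ^ 2 := by
      refine Asymptotics.IsBigO.of_bound B ?_
      filter_upwards [Iic_mem_nhds (show (0 : ℝ) < 1 / 2 by norm_num)] with t ht
      rw [Real.norm_eq_abs, Real.norm_of_nonneg (sq_nonneg t)]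
      exact hbound t ht
    have := hO.trans_isLittleO (Asymptotics.isLittleO_pow_id (𝕜 := ℝ) one_lt_two)
    simpa [h0] using this
  have h0 : iteratedDeriv n (costep s) 0 = 0 := by
    induction n with
    | zero => simpa using costep_of_nonpos le_rfl
    | succ n ih => rw [iteratedDeriv_succ]; exact (hder n ih).deriv
  refine ⟨fun t ht => ?_, hder n h0⟩
  rcases ht.lt_or_eq with ht | ht
  · exact hneg n t ht
  · rw [ht]; exact h0

theorem iteratedDeriv_stepFn (s : ℝ) (n : ℕ) (t : ℝ) :
    iteratedDeriv n (stepFn s) t = (-1) ^ n * iteratedDeriv n (costep s) (1 - t) := by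
  have : stepFn s = fun z => costep s (1 - z) := by
    funext z
    rw [← stepFn_one_sub, sub_sub_cancel]
  rw [this, iteratedDeriv_comp_const_sub]
  exact smul_eq_mul _ _

theorem iteratedDeriv_costep_one_sub (s : ℝ) {n : ℕ} (hn : 0 < n) (t : ℝ) :
    iteratedDeriv n (costep s) t = -((-1) ^ n * iteratedDeriv n (costep s) (1 - t)) := by
  rw [← iteratedDeriv_stepFn]
  have : costep s = fun z => 1 - stepFn s z := rfl
  conv_lhs => rw [this, iteratedDeriv_const_sub hn, iteratedDeriv_neg]

theorem differentiable_iteratedDeriv_costep {s : ℝ} (hs1 : 1 < s) (hs2 : s < 2) (n : ℕ) :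
    Differentiable ℝ (iteratedDeriv n (costep s)) := by
  obtain ⟨c, A, hc, hA, h⟩ := exists_iteratedDeriv_costep_near hs1 hs2
  have hle : ∀ n : ℕ, ∀ t ≤ 1 / 2, DifferentiableAt ℝ (iteratedDeriv n (costep s)) t := by
    intro n t ht2
    rcases lt_trichotomy t 0 with ht | ht | ht
    · have : iteratedDeriv n (costep s) =ᶠ[𝓝 t] fun _ => 0 := by
        filter_upwards [Iio_mem_nhds ht] with x hx
        exact (iteratedDeriv_costep_nonpos hs1 hs2 n).1 x (le_of_lt hx)
      exact (differentiableAt_const 0).congr_of_eventuallyEq this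
    · rw [ht]
      exact (iteratedDeriv_costep_nonpos hs1 hs2 n).2.differentiableAt
    · exact (h t ht ht2 n).1
  intro t
  rcases le_total t (1 / 2) with ht | ht
  · exact hle n t ht
  have h1 : DifferentiableAt ℝ (fun x => iteratedDeriv n (costep s) (1 - x)) t :=
    DifferentiableAt.comp t (hle n (1 - t) (by linarith))
      ((differentiableAt_const 1).sub differentiableAt_id)
  rcases Nat.eq_zero_or_pos n with rfl | hn
  · have : iteratedDeriv 0 (costep s) = fun x => 1 - iteratedDeriv 0 (costep s) (1 - x) := by
      funext x
      simp only [iteratedDeriv_zero]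
      rw [← stepFn_one_sub, costep, sub_sub_cancel]
    rw [this]
    exact h1.const_sub 1
  · have : iteratedDeriv n (costep s) =
        fun x => -((-1) ^ n * iteratedDeriv n (costep s) (1 - x)) := by
      funext x
      exact iteratedDeriv_costep_one_sub s hn x
    rw [this]
    exact (h1.const_mul _).neg

theorem contDiff_stepFn {s : ℝ} (hs1 : 1 < s) (hs2 : s < 2) :
    ContDiff ℝ (⊤ : ℕ∞) (stepFn s) := by
  refine contDiff_of_differentiable_iteratedDeriv fun m _ => ?_
  rw [funext (iteratedDeriv_stepFn s m)]
  exact ((differentiable_iteratedDeriv_costep hs1 hs2 m).comp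
    ((differentiable_const 1).sub differentiable_id)).const_mul _

/-- The step function is Gevrey of order `s`. -/
theorem exists_gevrey_stepFn {s : ℝ} (hs1 : 1 < s) (hs2 : s < 2) :
    ∃ A a : ℝ, 0 < A ∧ 0 < a ∧ ∀ (n : ℕ) (t : ℝ),
      |iteratedDeriv n (stepFn s) t| ≤ A * a ^ n * (n.factorial : ℝ) ^ s := by
  obtain ⟨c, A, hc, hA, h⟩ := exists_iteratedDeriv_costep_near hs1 hs2
  have hle : ∀ n : ℕ, ∀ t ≤ 1 / 2, |iteratedDeriv n (costep s) t| ≤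
      A * (2 / c) ^ n * (n.factorial : ℝ) ^ s := by
    intro n t ht2
    rcases le_or_gt t 0 with ht | ht
    · rw [(iteratedDeriv_costep_nonpos hs1 hs2 n).1 t ht, abs_zero]; positivity
    · refine ((h t ht ht2 n).2).trans ?_
      have := inv_pow_mul_exp_le hs1 hs2 ht n
      calc n.factorial * (A * Real.exp (-(t ^ (-(s - 1)⁻¹) / 2))) / (c * t) ^ n
          = n.factorial * A / c ^ n * (Real.exp (-(t ^ (-(s - 1)⁻¹) / 2)) / t ^ n) := by
            rw [mul_pow]; field_simp
        _ ≤ n.factorial * A / c ^ n * (2 ^ n * (n.factorial : ℝ) ^ (s - 1)) := by gcongr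
        _ = A * (2 / c) ^ n * (n.factorial : ℝ) ^ s := by
            rw [← factorial_rpow_mul s n, div_pow]
            generalize (n.factorial : ℝ) ^ (s - 1) = u
            ring
  -- The summand 1 is needed only for n = 0, where |φ_s| ≤ 1 + |1-φ_s|; higher derivatives of φ_s
  -- and 1-φ_s differ by a sign.
  refine ⟨1 + A, 2 / c, by positivity, by positivity, fun n t => ?_⟩
  have hA1 : A * (2 / c) ^ n * (n.factorial : ℝ) ^ s ≤
      (1 + A) * (2 / c) ^ n * (n.factorial : ℝ) ^ s := by gcongr; linarith
  rw [iteratedDeriv_stepFn, abs_mul, abs_pow, abs_neg, abs_one, one_pow, one_mul]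
  rcases le_total (1 - t) (1 / 2) with ht | ht
  · exact (hle n _ ht).trans hA1
  rcases Nat.eq_zero_or_pos n with rfl | hn
  · have := hle 0 t (by linarith)
    simp only [iteratedDeriv_zero, pow_zero, Nat.factorial_zero, Nat.cast_one,
      Real.one_rpow, mul_one] at this ⊢
    rw [← stepFn_one_sub, sub_sub_cancel]
    have h2 : stepFn s t = 1 - costep s t := by rw [costep]; ring
    rw [h2]
    exact (abs_sub _ _).trans (by rw [abs_one]; linarith)
  · rw [iteratedDeriv_costep_one_sub s hn, sub_sub_cancel, abs_neg, abs_mul, abs_pow, abs_neg,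
      abs_one, one_pow, one_mul]
    exact (hle n t (by linarith)).trans hA1

/-! ### Products and sums of Gevrey sequences -/

/-- In Leibniz' formula j!^s (n-j)! ≤ (j! (n-j)!)^s ≤ n!^s because s ≥ 1, and what remains is the
binomial expansion of (a + 1/r)^n. The bound is linear in M, so a small analytic factor gives a
small product. -/
theorem gevrey_mul {f g : ℝ → ℝ} {t s A a M r : ℝ} (hs : 1 ≤ s) (hA : 0 ≤ A) (ha : 0 ≤ a)
    (hr : 0 < r) (hM : 0 ≤ M)
    (hf : ContDiffAt ℝ (⊤ : ℕ∞) f t) (hg : ContDiffAt ℝ (⊤ : ℕ∞) g t)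
    (hfb : ∀ n : ℕ, |iteratedDeriv n f t| ≤ A * a ^ n * (n.factorial : ℝ) ^ s)
    (hgb : ∀ n : ℕ, |iteratedDeriv n g t| ≤ n.factorial * M / r ^ n) (n : ℕ) :
    |iteratedDeriv n (fun x => f x * g x) t| ≤
      A * M * (a + r⁻¹) ^ n * (n.factorial : ℝ) ^ s := by
  have hn : ((n : ℕ∞) : WithTop ℕ∞) ≤ ((⊤ : ℕ∞) : WithTop ℕ∞) := by exact_mod_cast le_top
  rw [iteratedDeriv_fun_mul (hf.of_le hn) (hg.of_le hn), add_pow]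
  refine (Finset.abs_sum_le_sum_abs _ _).trans ?_
  rw [Finset.mul_sum, Finset.sum_mul]
  refine Finset.sum_le_sum fun j hj => ?_
  have hj' : j ≤ n := Nat.lt_succ_iff.1 (Finset.mem_range.1 hj)
  rw [abs_mul, abs_mul, Nat.abs_cast]
  have hfac : (j.factorial : ℝ) ^ s * ((n - j).factorial : ℝ) ≤ (n.factorial : ℝ) ^ s := by
    have h1 : ((n - j).factorial : ℝ) ≤ ((n - j).factorial : ℝ) ^ s := by
      conv_lhs => rw [← Real.rpow_one ((n - j).factorial : ℝ)]
      exact Real.rpow_le_rpow_of_exponent_le (by exact_mod_cast Nat.factorial_pos _) hs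
    calc (j.factorial : ℝ) ^ s * ((n - j).factorial : ℝ)
        ≤ (j.factorial : ℝ) ^ s * ((n - j).factorial : ℝ) ^ s := by gcongr
      _ = ((j.factorial : ℝ) * (n - j).factorial) ^ s :=
        (Real.mul_rpow (by positivity) (by positivity)).symm
      _ ≤ (n.factorial : ℝ) ^ s := by
        gcongr
        exact_mod_cast Nat.le_of_dvd (Nat.factorial_pos _)
          (Nat.factorial_mul_factorial_dvd_factorial hj')
  calc (n.choose j : ℝ) * |iteratedDeriv j f t| * |iteratedDeriv (n - j) g t|
      ≤ n.choose j * (A * a ^ j * (j.factorial : ℝ) ^ s) *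
          ((n - j).factorial * M / r ^ (n - j)) := by
        gcongr
        · exact hfb j
        · exact hgb _
    _ = A * M * (a ^ j * r⁻¹ ^ (n - j) * n.choose j) *
          ((j.factorial : ℝ) ^ s * (n - j).factorial) := by
        rw [inv_pow]; field_simp
    _ ≤ A * M * (a ^ j * r⁻¹ ^ (n - j) * n.choose j) * (n.factorial : ℝ) ^ s := by gcongr

theorem summable_pow_div_factorial_rpow {ρ η : ℝ} (hρ : 0 < ρ) (hη : 0 < η) :
    Summable fun i : ℕ => ρ ^ i / (i.factorial : ℝ) ^ η := by
  refine summable_of_ratio_test_tendsto_lt_one (l := 0) one_pos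
    (Eventually.of_forall fun n => by positivity) ?_
  have : ∀ n : ℕ, ‖ρ ^ (n + 1) / ((n + 1).factorial : ℝ) ^ η‖ / ‖ρ ^ n / (n.factorial : ℝ) ^ η‖ =
      ρ * ((n + 1 : ℕ) : ℝ) ^ (-η) := by
    intro n
    rw [Real.norm_of_nonneg (by positivity), Real.norm_of_nonneg (by positivity),
      Nat.factorial_succ, Nat.cast_mul, Real.mul_rpow (by positivity) (by positivity),
      Real.rpow_neg (by positivity), pow_succ]
    field_simp
  simp_rw [this]
  have h := ((tendsto_rpow_neg_atTop hη).comp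
    (tendsto_natCast_atTop_atTop.comp (tendsto_add_atTop_nat 1))).const_mul ρ
  simpa using h

/-- The weights in the series `∑ y^{(i)} x^{2i} / (2i)!` for `y` Gevrey of order `s`. -/
noncomputable def gevreyWeight (s ρ : ℝ) (i : ℕ) : ℝ :=
  ρ ^ i * (i.factorial : ℝ) ^ s / ((2 * i).factorial : ℝ)

theorem gevreyWeight_nonneg {s ρ : ℝ} (hρ : 0 < ρ) (i : ℕ) : 0 ≤ gevreyWeight s ρ i := by
  unfold gevreyWeight; positivity

/-- From i!² ≤ (2i)!; this is where order s < 2 makes the series in x converge. -/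
theorem gevreyWeight_le {s ρ : ℝ} (hρ : 0 < ρ) (i : ℕ) :
    gevreyWeight s ρ i ≤ ρ ^ i / (i.factorial : ℝ) ^ (2 - s) := by
  have h : (i.factorial : ℝ) ^ (2 : ℝ) ≤ ((2 * i).factorial : ℝ) := by
    rw [Real.rpow_two, sq, two_mul]
    exact_mod_cast Nat.le_of_dvd (Nat.factorial_pos _)
      (Nat.factorial_mul_factorial_dvd_factorial_add i i)
  unfold gevreyWeight
  calc ρ ^ i * (i.factorial : ℝ) ^ s / ((2 * i).factorial : ℝ)
      ≤ ρ ^ i * (i.factorial : ℝ) ^ s / (i.factorial : ℝ) ^ (2 : ℝ) := by gcongr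
    _ = ρ ^ i / (i.factorial : ℝ) ^ (2 - s) := by
      rw [Real.rpow_sub (by positivity)]; field_simp

theorem summable_gevreyWeight {s ρ : ℝ} (hs2 : s < 2) (hρ : 0 < ρ) :
    Summable (gevreyWeight s ρ) :=
  Summable.of_nonneg_of_le (gevreyWeight_nonneg hρ) (gevreyWeight_le hρ)
    (summable_pow_div_factorial_rpow hρ (by linarith))

theorem gevreyWeight_mul_pow (s ρ x : ℝ) (i : ℕ) :
    gevreyWeight s ρ i * x ^ (2 * i) = gevreyWeight s (ρ * x ^ 2) i := by
  unfold gevreyWeight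
  rw [mul_pow, pow_mul]; ring

/-- Shifting the derivative index by one only changes the geometric rate. -/
theorem pow_succ_mul_factorial_le {s ρ : ℝ} (hs2 : s ≤ 2) (hρ : 0 < ρ) (i : ℕ) :
    ρ ^ (i + 1) * ((i + 1).factorial : ℝ) ^ s / ((2 * i).factorial : ℝ) ≤
      ρ * gevreyWeight s (4 * ρ) i := by
  have h1 : ((i + 1 : ℕ) : ℝ) ^ s ≤ 4 ^ i := by
    have h2 : ((i + 1 : ℕ) : ℝ) ≤ 2 ^ i := by exact_mod_cast Nat.lt_two_pow_self
    calc ((i + 1 : ℕ) : ℝ) ^ s ≤ ((i + 1 : ℕ) : ℝ) ^ (2 : ℝ) :=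
          Real.rpow_le_rpow_of_exponent_le (by push_cast; linarith [i.cast_nonneg (α := ℝ)]) hs2
      _ ≤ (2 ^ i) ^ (2 : ℝ) := by gcongr
      _ = 4 ^ i := by rw [Real.rpow_two, ← pow_mul, mul_comm, pow_mul]; norm_num
  unfold gevreyWeight
  rw [Nat.factorial_succ, Nat.cast_mul, Real.mul_rpow (by positivity) (by positivity), mul_pow]
  calc ρ ^ (i + 1) * (((i + 1 : ℕ) : ℝ) ^ s * (i.factorial : ℝ) ^ s) / ((2 * i).factorial : ℝ)
      ≤ ρ ^ (i + 1) * (4 ^ i * (i.factorial : ℝ) ^ s) / ((2 * i).factorial : ℝ) := by gcongr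
    _ = ρ * (4 ^ i * ρ ^ i * (i.factorial : ℝ) ^ s / ((2 * i).factorial : ℝ)) := by
      rw [pow_succ]; ring

/-- The denominator i!^{2-s} is split into two factors i!^η. One yields e^{-η I ln I} for i ≥ I,
through I^I ≤ I! e^I; the other keeps the sum finite, with rate ρe^η. At I = 0 the convention 0 ln 0
= 0 is the value `Real.log 0 = 0`. -/
theorem exists_tail_gevreyWeight {s ρ : ℝ} (hs2 : s < 2) (hρ : 0 < ρ) :
    ∃ C : ℝ, 0 < C ∧ ∀ I : ℕ, ∑' i : ℕ, gevreyWeight s ρ (i + (I + 1)) ≤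
      C * Real.exp (-((2 - s) / 2) * (I * Real.log I)) := by
  set η : ℝ := (2 - s) / 2 with hη
  have hη0 : 0 < η := by rw [hη]; linarith
  set v : ℕ → ℝ := fun i => (ρ * Real.exp η) ^ i / (i.factorial : ℝ) ^ η with hv
  have hvs : Summable v := summable_pow_div_factorial_rpow (by positivity) hη0
  have hv0 : ∀ i, 0 ≤ v i := fun i => by rw [hv]; positivity
  have key : ∀ I i : ℕ, I ≤ i →
      gevreyWeight s ρ i ≤ Real.exp (-η * (I * Real.log I)) * v i := by
    intro I i hi
    have h1 : Real.exp (I * Real.log I) ≤ I.factorial * Real.exp I := by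
      have h2 := Real.pow_div_factorial_le_exp (I : ℝ) (by positivity) I
      rw [div_le_iff₀ (by positivity), mul_comm] at h2
      refine le_trans ?_ h2
      rcases Nat.eq_zero_or_pos I with rfl | hI
      · simp
      · rw [mul_comm, Real.exp_mul, Real.exp_log (by exact_mod_cast hI), Real.rpow_natCast]
    have h3 : Real.exp (I * Real.log I) ≤ i.factorial * Real.exp i := by
      refine h1.trans ?_
      gcongr
    have h4 : Real.exp (η * (I * Real.log I)) ≤ (i.factorial : ℝ) ^ η * Real.exp η ^ i := by
      have := Real.rpow_le_rpow (by positivity) h3 hη0.le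
      rwa [Real.mul_rpow (by positivity) (by positivity), ← Real.exp_mul, ← Real.exp_mul,
        mul_comm _ η, mul_comm _ η, Real.exp_mul η i, Real.rpow_natCast] at this
    refine (gevreyWeight_le hρ i).trans ?_
    have h5 : (i.factorial : ℝ) ^ (2 - s) = (i.factorial : ℝ) ^ η * (i.factorial : ℝ) ^ η := by
      rw [← Real.rpow_add (by positivity)]; congr 1; rw [hη]; ring
    rw [h5, hv, neg_mul, Real.exp_neg]
    simp only
    rw [mul_pow, inv_mul_eq_div, div_div, div_le_div_iff₀ (by positivity) (by positivity)]
    calc ρ ^ i * ((i.factorial : ℝ) ^ η * Real.exp (η * (I * Real.log I)))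
        ≤ ρ ^ i * ((i.factorial : ℝ) ^ η * ((i.factorial : ℝ) ^ η * Real.exp η ^ i)) := by gcongr
      _ = _ := by ring
  refine ⟨∑' i, v i + 1, by linarith [tsum_nonneg hv0 (L := .unconditional ℕ)], fun I => ?_⟩
  have hinj : Function.Injective fun i : ℕ => i + (I + 1) := add_left_injective _
  calc ∑' i : ℕ, gevreyWeight s ρ (i + (I + 1))
      ≤ ∑' i : ℕ, Real.exp (-η * (I * Real.log I)) * v (i + (I + 1)) :=
        Summable.tsum_le_tsum (fun i => key I _ (by omega))
          ((summable_gevreyWeight hs2 hρ).comp_injective hinj)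
          ((hvs.comp_injective hinj).mul_left _)
    _ = Real.exp (-η * (I * Real.log I)) * ∑' i : ℕ, v (i + (I + 1)) := tsum_mul_left
    _ ≤ Real.exp (-η * (I * Real.log I)) * (∑' i, v i + 1) := by
        exact mul_le_mul_of_nonneg_left
          ((tsum_comp_le_tsum_of_inj hvs hv0 hinj).trans (by linarith)) (Real.exp_pos _).le
    _ = _ := mul_comm _ _

/-! ### Exponential series with bounded coefficients -/

/-- `e^{-n²π²t}` for real `t`. -/
noncomputable def heatDecay (t : ℝ) (n : ℕ) : ℝ := Real.exp (-(n : ℝ) ^ 2 * Real.pi ^ 2 * t)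

theorem heatDecay_pos (t : ℝ) (n : ℕ) : 0 < heatDecay t n := Real.exp_pos _

theorem summable_heatDecay {δ : ℝ} (hδ : 0 < δ) : Summable (heatDecay δ) := by
  have hlt : Real.exp (-(Real.pi ^ 2 * δ)) < 1 := by
    rw [Real.exp_lt_one_iff]
    have := Real.pi_pos
    have : 0 < Real.pi ^ 2 * δ := by positivity
    linarith
  refine Summable.of_nonneg_of_le (fun n => (heatDecay_pos δ n).le) (fun n => ?_)
    (summable_geometric_of_lt_one (Real.exp_pos _).le hlt)
  rw [heatDecay, ← Real.exp_nat_mul]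
  apply Real.exp_le_exp.2
  have h1 : (n : ℝ) ≤ (n : ℝ) ^ 2 := by
    exact_mod_cast Nat.le_self_pow two_ne_zero n
  have : (n : ℝ) * (Real.pi ^ 2 * δ) ≤ (n : ℝ) ^ 2 * (Real.pi ^ 2 * δ) := by gcongr
  linarith

theorem heatDecay_anti {a b : ℝ} (h : a ≤ b) (n : ℕ) : heatDecay b n ≤ heatDecay a n := by
  unfold heatDecay
  apply Real.exp_le_exp.2
  have : (n : ℝ) ^ 2 * Real.pi ^ 2 * a ≤ (n : ℝ) ^ 2 * Real.pi ^ 2 * b := by gcongr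
  linarith

theorem heatDecay_add (a b : ℝ) (n : ℕ) : heatDecay (a + b) n = heatDecay a n * heatDecay b n := by
  unfold heatDecay; rw [← Real.exp_add]; congr 1; ring

/-- The term `c_n e^{-n²π²z}`. -/
noncomputable def expTerm (c : ℕ → ℝ) (n : ℕ) (z : ℂ) : ℂ :=
  c n * Complex.exp (-(n : ℂ) ^ 2 * Real.pi ^ 2 * z)

theorem norm_expTerm (c : ℕ → ℝ) (n : ℕ) (z : ℂ) :
    ‖expTerm c n z‖ = |c n| * heatDecay z.re n := by
  have : (-(n : ℂ) ^ 2 * Real.pi ^ 2 * z).re = -(n : ℝ) ^ 2 * Real.pi ^ 2 * z.re := by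
    have h : (-(n : ℂ) ^ 2 * Real.pi ^ 2 * z) = ((-(n : ℝ) ^ 2 * Real.pi ^ 2 : ℝ) : ℂ) * z := by
      push_cast; ring
    rw [h, Complex.re_ofReal_mul]
  rw [expTerm, norm_mul, Complex.norm_real, Complex.norm_exp, this, Real.norm_eq_abs, heatDecay]

/-- `∑ c_n e^{-n²π²z}`, on the half plane `Re z > 0`. -/
noncomputable def expSum (c : ℕ → ℝ) (z : ℂ) : ℂ := ∑' n : ℕ, expTerm c n z

theorem norm_expTerm_le {c : ℕ → ℝ} {B : ℝ} (hc : ∀ n, |c n| ≤ B)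
    {δ : ℝ} {z : ℂ} (hz : δ ≤ z.re) (n : ℕ) :
    ‖expTerm c n z‖ ≤ B * heatDecay δ n := by
  rw [norm_expTerm]
  have hB := (abs_nonneg _).trans (hc n)
  have := (heatDecay_pos z.re n).le
  gcongr
  · exact hc n
  · exact heatDecay_anti hz n

theorem summable_expTerm {c : ℕ → ℝ} {B : ℝ} (hc : ∀ n, |c n| ≤ B)
    {z : ℂ} (hz : 0 < z.re) : Summable fun n => expTerm c n z :=
  Summable.of_norm_bounded ((summable_heatDecay hz).mul_left B) (norm_expTerm_le hc le_rfl)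

theorem differentiableOn_expSum {c : ℕ → ℝ} {B : ℝ} (hc : ∀ n, |c n| ≤ B) :
    DifferentiableOn ℂ (expSum c) {z | 0 < z.re} := by
  intro z hz
  have hz' : 0 < z.re := hz
  have hopen : IsOpen {w : ℂ | z.re / 2 < w.re} := isOpen_lt continuous_const Complex.continuous_re
  have h := Complex.differentiableOn_tsum_of_summable_norm (F := fun n => expTerm c n)
    ((summable_heatDecay (half_pos hz')).mul_left B) (fun n => ?_) hopen
    (fun n w hw => norm_expTerm_le hc (le_of_lt hw) n)
  · exact (h.differentiableAt (hopen.mem_nhds (by simpa using hz'))).differentiableWithinAt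
  · unfold expTerm
    fun_prop

theorem norm_expSum_le {c : ℕ → ℝ} {B : ℝ} (hc : ∀ n, |c n| ≤ B)
    {δ : ℝ} (hδ : 0 < δ) {z : ℂ} (hz : δ ≤ z.re) :
    ‖expSum c z‖ ≤ B * ∑' n, heatDecay δ n :=
  tsum_of_norm_bounded ((summable_heatDecay hδ).hasSum.mul_left B) (norm_expTerm_le hc hz)

/-- Half of the decay is spent on smallness in N, the other half on summability. -/
theorem norm_expSum_sub_sum_le {c : ℕ → ℝ} {B : ℝ} (hc : ∀ n, |c n| ≤ B)
    {δ : ℝ} (hδ : 0 < δ) {z : ℂ} (hz : δ ≤ z.re) (N : ℕ) :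
    ‖expSum c z - ∑ n ∈ Finset.range (N + 1), expTerm c n z‖ ≤
      B * heatDecay (δ / 2) N * ∑' n, heatDecay (δ / 2) n := by
  have hB := (abs_nonneg _).trans (hc 0)
  have hinj : Function.Injective fun i : ℕ => i + (N + 1) := add_left_injective _
  have hs := summable_heatDecay (half_pos hδ)
  rw [expSum, ← (summable_expTerm hc (hδ.trans_le hz)).sum_add_tsum_nat_add (N + 1),
    add_sub_cancel_left]
  refine (tsum_of_norm_bounded (((hs.comp_injective hinj).hasSum).mul_left
    (B * heatDecay (δ / 2) N)) fun n => ?_).trans ?_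
  · refine (norm_expTerm_le hc hz _).trans ?_
    have h1 : heatDecay δ (n + (N + 1)) =
        heatDecay (δ / 2) (n + (N + 1)) * heatDecay (δ / 2) (n + (N + 1)) := by
      rw [← heatDecay_add, add_halves]
    have h2 : heatDecay (δ / 2) (n + (N + 1)) ≤ heatDecay (δ / 2) N := by
      unfold heatDecay
      apply Real.exp_le_exp.2
      have : (N : ℝ) ^ 2 * Real.pi ^ 2 * (δ / 2) ≤
          ((n + (N + 1) : ℕ) : ℝ) ^ 2 * Real.pi ^ 2 * (δ / 2) := by
        gcongr
        omega
      linarith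
    rw [h1, mul_assoc, Function.comp_apply]
    gcongr
    exact (heatDecay_pos _ _).le
  · exact mul_le_mul_of_nonneg_left
      (tsum_comp_le_tsum_of_inj hs (fun n => (heatDecay_pos _ n).le) hinj)
      (mul_nonneg hB (heatDecay_pos (δ / 2) N).le)

/-- Inserting l^{k-K} ≥ 1 in each term with k > K compares the tail of e^{|w|} with l^{-K} times
that of e^{l|w|}. The decay in K is uniform in w; the larger exponent is later absorbed by
e^{-n²π²τ}. -/
theorem norm_exp_sub_sum_le {l : ℝ} (hl : 1 ≤ l) (w : ℂ) (K : ℕ) :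
    ‖Complex.exp w - ∑ k ∈ Finset.range (K + 1), w ^ k / (k.factorial : ℂ)‖ ≤
      l⁻¹ ^ K * Real.exp (l * ‖w‖) := by
  refine (Complex.norm_exp_sub_sum_le_exp_norm_sub_sum w (K + 1)).trans ?_
  have hl0 : 0 < l := by linarith
  have hsum : ∀ x : ℝ, HasSum (fun k : ℕ => x ^ k / (k.factorial : ℝ)) (Real.exp x) := fun x => by
    rw [Real.exp_eq_exp_ℝ]; exact NormedSpace.expSeries_div_hasSum_exp x
  have hinj : Function.Injective fun i : ℕ => i + (K + 1) := add_left_injective _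
  rw [← (hsum ‖w‖).tsum_eq, ← (hsum ‖w‖).summable.sum_add_tsum_nat_add (K + 1),
    add_sub_cancel_left, ← (hsum (l * ‖w‖)).tsum_eq]
  have hs2 := (hsum (l * ‖w‖)).summable
  calc ∑' k : ℕ, ‖w‖ ^ (k + (K + 1)) / ((k + (K + 1)).factorial : ℝ)
      ≤ ∑' k : ℕ, l⁻¹ ^ K * ((l * ‖w‖) ^ (k + (K + 1)) / ((k + (K + 1)).factorial : ℝ)) := by
        refine Summable.tsum_le_tsum (fun k => ?_) ((hsum ‖w‖).summable.comp_injective hinj)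
          ((hs2.comp_injective hinj).mul_left _)
        have h1 : l ^ (k + (K + 1)) * l⁻¹ ^ K = l ^ (k + 1) := by
          rw [inv_pow, show k + (K + 1) = (k + 1) + K by ring, pow_add]
          field_simp
        have h2 : 1 ≤ l ^ (k + 1) := one_le_pow₀ hl
        have h3 : l⁻¹ ^ K * ((l * ‖w‖) ^ (k + (K + 1)) / ((k + (K + 1)).factorial : ℝ)) =
            l ^ (k + 1) * (‖w‖ ^ (k + (K + 1)) / ((k + (K + 1)).factorial : ℝ)) := by
          rw [mul_pow, ← h1]; ring
        rw [h3]
        exact le_mul_of_one_le_left (by positivity) h2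
    _ = l⁻¹ ^ K * ∑' k : ℕ, ((l * ‖w‖) ^ (k + (K + 1)) / ((k + (K + 1)).factorial : ℝ)) :=
        tsum_mul_left
    _ ≤ _ := by
        exact mul_le_mul_of_nonneg_left
          (tsum_comp_le_tsum_of_inj hs2 (fun k => by positivity) hinj) (by positivity)

/-! ### The cosine coefficients -/

instance : IsProbabilityMeasure unitMeasure :=
  ⟨by simp [unitMeasure]⟩

theorem memLp_cos (a : ℝ) (n : ℕ) :
    MemLp (fun x : ℝ => a * Real.cos (n * Real.pi * x)) 2 unitMeasure := by
  refine MemLp.of_bound (by fun_prop) |a| (Eventually.of_forall fun x => ?_)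
  rw [norm_mul, Real.norm_eq_abs, Real.norm_eq_abs]
  exact mul_le_of_le_one_right (abs_nonneg _) (Real.abs_cos_le_one _)

theorem norm_toLp_cos_le (a : ℝ) (n : ℕ) : ‖(memLp_cos a n).toLp‖ ≤ |a| := by
  have h := Lp.norm_le_of_ae_bound (f := (memLp_cos a n).toLp) (C := |a|) (abs_nonneg a) (by
    filter_upwards [(memLp_cos a n).coeFn_toLp] with x hx
    rw [hx, norm_mul, Real.norm_eq_abs, Real.norm_eq_abs]
    exact mul_le_of_le_one_right (abs_nonneg _) (Real.abs_cos_le_one _))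
  have h1 : measureUnivNNReal unitMeasure = 1 := by
    simp [measureUnivNNReal]
  simpa [h1] using h

theorem integral_mul_cos (θ₀ : L2) (a : ℝ) (n : ℕ) :
    ∫ x, θ₀ x * (a * Real.cos (n * Real.pi * x)) ∂unitMeasure =
      inner ℝ θ₀ (memLp_cos a n).toLp := by
  rw [L2.inner_def]
  refine integral_congr_ae ?_
  filter_upwards [(memLp_cos a n).coeFn_toLp] with x hx
  rw [hx]
  simp [mul_comm]

/-- For t > 0 the estimates need only this bound on the coefficients, and through it ‖θ₀‖ enters
them linearly. -/
theorem abs_cosCoeff_le (θ₀ : L2) (n : ℕ) : |cosCoeff θ₀ n| ≤ Real.sqrt 2 * ‖θ₀‖ := by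
  rw [cosCoeff, integral_mul_cos, abs_mul]
  have h1 : |(if n = 0 then 1 / 2 else 1 : ℝ)| ≤ 1 := by
    split_ifs <;> norm_num [abs_of_pos]
  have h2 := (abs_real_inner_le_norm θ₀ (memLp_cos (Real.sqrt 2) n).toLp).trans
    (mul_le_mul_of_nonneg_left (norm_toLp_cos_le _ n) (norm_nonneg _))
  rw [abs_of_nonneg (Real.sqrt_nonneg 2), mul_comm ‖θ₀‖] at h2
  calc _ ≤ 1 * (Real.sqrt 2 * ‖θ₀‖) := by gcongr
    _ = _ := one_mul _

/-! ### Interchange of summations -/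

theorem hasSum_of_eq {f g : ℕ → ℝ} {a : ℝ} (h : ∀ k, f k = g k) (hg : HasSum g a) :
    HasSum f a := by
  rwa [funext h]

/-- Fubini for double series, in the form used below: the rows are exponential or cosine series
whose absolute sums `b` are explicit exponentials or hyperbolic cosines. -/
theorem hasSum_tsum_comm {f : ℕ → ℕ → ℝ} {b g : ℕ → ℝ}
    (habs : ∀ n, HasSum (fun k => |f n k|) (b n)) (hb : Summable b)
    (hf : ∀ n, HasSum (f n) (g n)) :
    (∀ k, Summable fun n => f n k) ∧ HasSum (fun k => ∑' n, f n k) (∑' n, g n) := by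
  have hS : Summable fun p : ℕ × ℕ => f p.1 p.2 := by
    refine Summable.of_abs ?_
    rw [summable_prod_of_nonneg fun p => abs_nonneg _]
    exact ⟨fun n => (habs n).summable, by simpa only [(habs _).tsum_eq] using hb⟩
  have hS' : Summable fun p : ℕ × ℕ => f p.2 p.1 := hS.prod_symm
  refine ⟨fun k => hS'.prod_factor k, ?_⟩
  have h1 : HasSum g (∑' p : ℕ × ℕ, f p.1 p.2) := hS.hasSum.prod_fiberwise hf
  have h2 : HasSum (fun k => ∑' n, f n k) (∑' p : ℕ × ℕ, f p.2 p.1) :=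
    hS'.hasSum.prod_fiberwise fun k => (hS'.prod_factor k).hasSum
  rw [h1.tsum_eq]
  have h3 : ∑' p : ℕ × ℕ, f p.2 p.1 = ∑' p : ℕ × ℕ, f p.1 p.2 :=
    (Equiv.prodComm ℕ ℕ).tsum_eq fun p : ℕ × ℕ => f p.1 p.2
  rwa [h3] at h2

theorem hasSum_pow_div_factorial (x : ℝ) :
    HasSum (fun k : ℕ => x ^ k / (k.factorial : ℝ)) (Real.exp x) := by
  rw [Real.exp_eq_exp_ℝ]; exact NormedSpace.expSeries_div_hasSum_exp x

theorem iteratedDeriv_eq_of_hasSum {f : ℝ → ℝ} {a : ℕ → ℝ} {x : ℝ}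
    (h : ∀ᶠ z in 𝓝 (0 : ℝ), HasSum (fun k : ℕ => a k * z ^ k / (k.factorial : ℝ)) (f (x + z)))
    (n : ℕ) : iteratedDeriv n f x = a n := by
  have hp : HasFPowerSeriesAt f
      (FormalMultilinearSeries.ofScalars ℝ fun k => a k / (k.factorial : ℝ)) x := by
    rw [hasFPowerSeriesAt_iff]
    filter_upwards [h] with z hz
    refine hasSum_of_eq (fun k => ?_) hz
    rw [FormalMultilinearSeries.coeff_ofScalars, smul_eq_mul]
    ring
  have hq := hp.analyticAt.hasFPowerSeriesAt
  have := congrArg (fun p => p.coeff n) (hp.eq_formalMultilinearSeries hq)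
  simp only [FormalMultilinearSeries.coeff_ofScalars] at this
  have hn : (n.factorial : ℝ) ≠ 0 := by positivity
  field_simp at this
  exact this.symm

/-! ### The uncontrolled flat output -/

/-- `√2 ∑ c_n e^{-n²π²t}`. -/
noncomputable def freeOutput (θ₀ : L2) (t : ℝ) : ℝ :=
  ∑' n : ℕ, Real.sqrt 2 * (cosCoeff θ₀ n * heatDecay t n)

theorem summable_cosCoeff_mul_heatDecay (θ₀ : L2) {t : ℝ} (ht : 0 < t) :
    Summable fun n => |cosCoeff θ₀ n| * heatDecay t n := by
  refine Summable.of_nonneg_of_le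
    (fun n => mul_nonneg (abs_nonneg _) (heatDecay_pos t n).le) (fun n => ?_)
    ((summable_heatDecay ht).mul_left (Real.sqrt 2 * ‖θ₀‖))
  exact mul_le_mul_of_nonneg_right (abs_cosCoeff_le θ₀ n) (heatDecay_pos t n).le

theorem expTerm_ofReal (c : ℕ → ℝ) (n : ℕ) (t : ℝ) :
    expTerm c n t = ((c n * heatDecay t n : ℝ) : ℂ) := by
  unfold expTerm heatDecay; push_cast; rfl

theorem freeOutput_eq_re (θ₀ : L2) (t : ℝ) :
    freeOutput θ₀ t = ((Real.sqrt 2 : ℂ) * expSum (cosCoeff θ₀) t).re := by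
  simp_rw [expSum, expTerm_ofReal]
  rw [← Complex.ofReal_tsum, ← Complex.ofReal_mul, Complex.ofReal_re, freeOutput, tsum_mul_left]

theorem isOpen_re_pos : IsOpen {z : ℂ | 0 < z.re} :=
  isOpen_lt continuous_const Complex.continuous_re

theorem contDiffAt_freeOutput (θ₀ : L2) {m : WithTop ℕ∞} {t : ℝ} (ht : 0 < t) :
    ContDiffAt ℝ m (freeOutput θ₀) t :=
  contDiffAt_of_holomorphic isOpen_re_pos
    ((differentiableOn_expSum (abs_cosCoeff_le θ₀)).const_mul (Real.sqrt 2 : ℂ))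
    (fun x _ => freeOutput_eq_re θ₀ x) (by simpa using ht)

theorem re_ge_of_mem_closedBall {a : ℝ} {r : ℝ} {z : ℂ}
    (hz : z ∈ Metric.closedBall (a : ℂ) r) : a - r ≤ z.re := by
  have h1 : ‖z - a‖ ≤ r := by simpa [dist_eq_norm] using hz
  have h2 : |z.re - a| ≤ r := by simpa using (Complex.abs_re_le_norm (z - a)).trans h1
  linarith [(abs_le.1 h2).1]

theorem abs_iteratedDeriv_freeOutput_le (θ₀ : L2) {δ t : ℝ} (hδ : 0 < δ) (ht : δ ≤ t) (n : ℕ) :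
    |iteratedDeriv n (freeOutput θ₀) t| ≤
      n.factorial * (2 * ‖θ₀‖ * ∑' k, heatDecay (δ / 2) k) / (δ / 2) ^ n := by
  have hre : ∀ z ∈ Metric.closedBall (t : ℂ) (δ / 2), δ / 2 ≤ z.re := fun z hz => by
    linarith [re_ge_of_mem_closedBall hz]
  refine abs_iteratedDeriv_le_of_holomorphic isOpen_re_pos
    ((differentiableOn_expSum (abs_cosCoeff_le θ₀)).const_mul (Real.sqrt 2 : ℂ))
    (fun x _ => freeOutput_eq_re θ₀ x) (half_pos hδ)
    (fun z hz => (half_pos hδ).trans_le (hre z hz)) (fun z hz => ?_) n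
  rw [norm_mul, Complex.norm_real, Real.norm_of_nonneg (Real.sqrt_nonneg 2)]
  calc Real.sqrt 2 * ‖expSum (cosCoeff θ₀) z‖
      ≤ Real.sqrt 2 * (Real.sqrt 2 * ‖θ₀‖ * ∑' k, heatDecay (δ / 2) k) := by
        gcongr
        exact norm_expSum_le (abs_cosCoeff_le θ₀) (half_pos hδ) (hre z hz)
    _ = (Real.sqrt 2 * Real.sqrt 2) * ‖θ₀‖ * ∑' k, heatDecay (δ / 2) k := by ring
    _ = _ := by rw [Real.mul_self_sqrt (by norm_num)]

theorem yTerm_eq (τ : ℝ) (θ₀ : L2) (k n : ℕ) :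
    yTerm τ θ₀ k n = cosCoeff θ₀ n * heatDecay τ n * (n : ℝ) ^ (2 * k) := rfl

theorem yCoeff_eq_tsum (τ : ℝ) (θ₀ : L2) (k : ℕ) :
    yCoeff τ θ₀ k =
      ∑' n : ℕ, Real.sqrt 2 * (cosCoeff θ₀ n * heatDecay τ n) * (-((n * Real.pi) ^ 2)) ^ k := by
  rw [yCoeff, ← tsum_mul_left, ← tsum_mul_right]
  congr 1 with n
  rw [yTerm_eq, show (-((n * Real.pi) ^ 2)) ^ k = (n : ℝ) ^ (2 * k) * (-Real.pi ^ 2) ^ k by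
    rw [pow_mul, ← mul_pow]; congr 1; ring]
  ring

theorem heatDecay_mul_exp (t h : ℝ) (n : ℕ) :
    heatDecay t n * Real.exp (-((n * Real.pi) ^ 2) * h) = heatDecay (t + h) n := by
  rw [heatDecay_add]; unfold heatDecay; congr 2; ring

/-- Taylor expansion of the free output at `t`. -/
theorem hasSum_freeOutput_taylor (θ₀ : L2) {t h : ℝ} (hh : |h| < t) :
    (∀ k, Summable fun n : ℕ =>
      Real.sqrt 2 * (cosCoeff θ₀ n * heatDecay t n) * ((-((n * Real.pi) ^ 2)) ^ k * h ^ k /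
        (k.factorial : ℝ))) ∧
    HasSum (fun k : ℕ => yCoeff t θ₀ k * h ^ k / (k.factorial : ℝ)) (freeOutput θ₀ (t + h)) := by
  -- The absolute row sums turn e^{-n²π²t} into e^{-n²π²(t-|h|)}, summable because |h| < t. At t = τ
  -- this is the source of the condition R' < τ.
  have key := hasSum_tsum_comm
    (f := fun n k => Real.sqrt 2 * (cosCoeff θ₀ n * heatDecay t n) *
      ((-((n * Real.pi) ^ 2)) ^ k * h ^ k / (k.factorial : ℝ)))
    (b := fun n => Real.sqrt 2 * (|cosCoeff θ₀ n| * heatDecay (t - |h|) n))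
    (g := fun n => Real.sqrt 2 * (cosCoeff θ₀ n * heatDecay (t + h) n)) ?_ ?_ ?_
  · refine ⟨key.1, ?_⟩
    refine hasSum_of_eq (fun k => ?_) key.2
    rw [yCoeff_eq_tsum, mul_div_assoc, ← tsum_mul_right]
    congr 1 with n
    ring
  · intro n
    have h1 := (hasSum_pow_div_factorial ((n * Real.pi) ^ 2 * |h|)).mul_left
      (Real.sqrt 2 * (|cosCoeff θ₀ n| * heatDecay t n))
    have e : Real.sqrt 2 * (|cosCoeff θ₀ n| * heatDecay (t - |h|) n) =
        Real.sqrt 2 * (|cosCoeff θ₀ n| * heatDecay t n) *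
          Real.exp ((n * Real.pi) ^ 2 * |h|) := by
      have := heatDecay_mul_exp t (-|h|) n
      rw [neg_mul_neg, ← sub_eq_add_neg] at this
      rw [← this]; ring
    rw [e]
    refine hasSum_of_eq (fun k => ?_) h1
    rw [abs_mul, abs_mul, abs_mul, abs_div, abs_mul, abs_pow, abs_pow, abs_neg,
      abs_of_nonneg (Real.sqrt_nonneg 2), abs_of_pos (heatDecay_pos t n),
      abs_of_nonneg (sq_nonneg ((n : ℝ) * Real.pi)), Nat.abs_cast, mul_pow _ |h|]
  · exact (summable_cosCoeff_mul_heatDecay θ₀ (by linarith)).mul_left _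
  · intro n
    have h1 := (hasSum_pow_div_factorial (-((n * Real.pi) ^ 2) * h)).mul_left
      (Real.sqrt 2 * (cosCoeff θ₀ n * heatDecay t n))
    rw [mul_assoc (Real.sqrt 2) _ (Real.exp _), mul_assoc _ _ (Real.exp _),
      heatDecay_mul_exp] at h1
    refine hasSum_of_eq (fun k => ?_) h1
    rw [mul_pow _ h]

theorem iteratedDeriv_freeOutput (θ₀ : L2) {t : ℝ} (ht : 0 < t) (k : ℕ) :
    iteratedDeriv k (freeOutput θ₀) t = yCoeff t θ₀ k := by
  refine iteratedDeriv_eq_of_hasSum ?_ k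
  filter_upwards [Metric.ball_mem_nhds (0 : ℝ) ht] with z hz
  exact (hasSum_freeOutput_taylor θ₀ (by simpa using hz)).2

theorem summable_yTerm (θ₀ : L2) {t : ℝ} (ht : 0 < t) (k : ℕ) : Summable (yTerm t θ₀ k) := by
  -- Any h with 0 < |h| < t would do: a column of the double series is the wanted series times a
  -- nonzero constant.
  have h := (hasSum_freeOutput_taylor (t := t) (h := t / 2) θ₀
    (by rw [abs_of_pos (half_pos ht)]; linarith)).1 k
  have h2 : Real.sqrt 2 ≠ 0 := by positivity
  have h3 := h.mul_left
    (((-Real.pi ^ 2) ^ k * (t / 2) ^ k / (k.factorial : ℝ) * Real.sqrt 2)⁻¹)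
  have hpi := Real.pi_ne_zero
  have hx : (-Real.pi ^ 2) ^ k ≠ 0 := pow_ne_zero _ (by simp [hpi])
  refine h3.congr fun n => ?_
  rw [yTerm_eq, show (-((n * Real.pi) ^ 2)) ^ k = (n : ℝ) ^ (2 * k) * (-Real.pi ^ 2) ^ k by
    rw [pow_mul, ← mul_pow]; congr 1; ring]
  have : (t / 2) ^ k ≠ 0 := by positivity
  have : (k.factorial : ℝ) ≠ 0 := by positivity
  field_simp

/-- By nπ|x| ≤ (nπ)²t/2 + x²/(2t), half of the decay pays for the growth of cosh. -/
theorem heatDecay_mul_cosh_le {t : ℝ} (ht : 0 < t) (x : ℝ) (n : ℕ) :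
    heatDecay t n * Real.cosh (n * Real.pi * x) ≤
      Real.exp (x ^ 2 / (2 * t)) * heatDecay (t / 2) n := by
  have h1 : Real.cosh (n * Real.pi * x) ≤ Real.exp |n * Real.pi * x| := by
    rw [← Real.cosh_abs, Real.cosh_eq]
    have : Real.exp (-|n * Real.pi * x|) ≤ Real.exp |n * Real.pi * x| :=
      Real.exp_le_exp.2 (by linarith [abs_nonneg (n * Real.pi * x)])
    linarith
  refine (mul_le_mul_of_nonneg_left h1 (heatDecay_pos t n).le).trans ?_
  unfold heatDecay
  rw [← Real.exp_add, ← Real.exp_add]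
  apply Real.exp_le_exp.2
  have h2 : |n * Real.pi * x| ≤ (n * Real.pi) ^ 2 * t / 2 + x ^ 2 / (2 * t) := by
    have h3 : (n * Real.pi) ^ 2 * t / 2 + x ^ 2 / (2 * t) =
        (((n * Real.pi) * t) ^ 2 + x ^ 2) / (2 * t) := by
      field_simp
    rw [h3, le_div_iff₀ (by positivity), abs_mul,
      abs_of_nonneg (by positivity : 0 ≤ n * Real.pi), ← sq_abs x]
    nlinarith [sq_nonneg (n * Real.pi * t - |x|)]
  linarith

/-- The free evolution as a series in the derivatives of the flat output. -/
theorem hasSum_freeOutput_cos (θ₀ : L2) {t : ℝ} (ht : 0 < t) (x : ℝ) :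
    HasSum (fun i : ℕ => iteratedDeriv i (freeOutput θ₀) t * x ^ (2 * i) /
      ((2 * i).factorial : ℝ))
      (∑' n : ℕ, cosCoeff θ₀ n * heatDecay t n *
        (Real.sqrt 2 * Real.cos (n * Real.pi * x))) := by
  have key := hasSum_tsum_comm
    (f := fun n i => Real.sqrt 2 * (cosCoeff θ₀ n * heatDecay t n) *
      ((-1) ^ i * (n * Real.pi * x) ^ (2 * i) / ((2 * i).factorial : ℝ)))
    (b := fun n => Real.sqrt 2 * (|cosCoeff θ₀ n| * heatDecay t n) *
      Real.cosh (n * Real.pi * x))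
    (g := fun n => cosCoeff θ₀ n * heatDecay t n *
        (Real.sqrt 2 * Real.cos (n * Real.pi * x))) ?_ ?_ ?_
  · refine hasSum_of_eq (fun i => ?_) key.2
    rw [iteratedDeriv_freeOutput θ₀ ht, yCoeff_eq_tsum, mul_div_assoc, ← tsum_mul_right]
    congr 1 with n
    rw [neg_pow ((n * Real.pi) ^ 2), mul_pow _ x, ← pow_mul]
    ring
  · intro n
    refine hasSum_of_eq (fun i => ?_) ((Real.hasSum_cosh (n * Real.pi * x)).mul_left
      (Real.sqrt 2 * (|cosCoeff θ₀ n| * heatDecay t n)))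
    rw [abs_mul, abs_mul, abs_mul, abs_div, abs_mul, abs_pow, abs_neg, abs_one, one_pow, one_mul,
      abs_of_nonneg (Real.sqrt_nonneg 2), abs_of_pos (heatDecay_pos t n), Nat.abs_cast,
      abs_of_nonneg (by rw [pow_mul]; positivity : 0 ≤ (n * Real.pi * x) ^ (2 * i))]
  · refine Summable.of_nonneg_of_le (fun n => ?_) (fun n => ?_)
      ((summable_heatDecay (half_pos ht)).mul_left
        (Real.sqrt 2 * (Real.sqrt 2 * ‖θ₀‖) * Real.exp (x ^ 2 / (2 * t))))
    · have := (heatDecay_pos t n).le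
      have := (Real.cosh_pos (n * Real.pi * x)).le
      positivity
    · calc Real.sqrt 2 * (|cosCoeff θ₀ n| * heatDecay t n) * Real.cosh (n * Real.pi * x)
          = Real.sqrt 2 * |cosCoeff θ₀ n| * (heatDecay t n * Real.cosh (n * Real.pi * x)) := by
            ring
        _ ≤ Real.sqrt 2 * (Real.sqrt 2 * ‖θ₀‖) *
            (Real.exp (x ^ 2 / (2 * t)) * heatDecay (t / 2) n) := by
          refine mul_le_mul ?_ (heatDecay_mul_cosh_le ht x n)
            (mul_nonneg (heatDecay_pos t n).le (Real.cosh_pos _).le) (by positivity)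
          gcongr
          exact abs_cosCoeff_le θ₀ n
        _ = _ := by ring
  · intro n
    have := (Real.hasSum_cos (n * Real.pi * x)).mul_left
      (Real.sqrt 2 * (cosCoeff θ₀ n * heatDecay t n))
    have e : cosCoeff θ₀ n * heatDecay t n * (Real.sqrt 2 * Real.cos (n * Real.pi * x)) =
        Real.sqrt 2 * (cosCoeff θ₀ n * heatDecay t n) * Real.cos (n * Real.pi * x) := by ring
    rwa [e]

/-! ### The rescaled step function -/

theorem contDiff_scaledStep {s : ℝ} (hs1 : 1 < s) (hs2 : s < 2) (τ R' : ℝ) :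
    ContDiff ℝ (⊤ : ℕ∞) fun t => stepFn s ((t - τ) / R') :=
  (contDiff_stepFn hs1 hs2).comp (by fun_prop)

theorem exists_gevrey_scaledStep {s : ℝ} (hs1 : 1 < s) (hs2 : s < 2) (τ : ℝ) {R' : ℝ}
    (hR : 0 < R') : ∃ A a : ℝ, 0 < A ∧ 0 < a ∧ ∀ (n : ℕ) (t : ℝ),
      |iteratedDeriv n (fun t => stepFn s ((t - τ) / R')) t| ≤
        A * a ^ n * (n.factorial : ℝ) ^ s := by
  obtain ⟨A, a, hA, ha, h⟩ := exists_gevrey_stepFn hs1 hs2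
  refine ⟨A, R'⁻¹ * a, hA, by positivity, fun n t => ?_⟩
  have h1 : iteratedDeriv n (fun t => stepFn s ((t - τ) / R')) t =
      R'⁻¹ ^ n * iteratedDeriv n (stepFn s) ((t - τ) / R') := by
    have e1 := congrFun (iteratedDeriv_comp_sub_const n (fun y => stepFn s (R'⁻¹ * y)) τ) t
    have hn : ((n : ℕ∞) : WithTop ℕ∞) ≤ ((⊤ : ℕ∞) : WithTop ℕ∞) := by exact_mod_cast le_top
    rw [iteratedDeriv_comp_const_mul ((contDiff_stepFn hs1 hs2).of_le hn)] at e1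
    simpa only [div_eq_inv_mul] using e1
  rw [h1, abs_mul, abs_of_nonneg (by positivity : 0 ≤ R'⁻¹ ^ n), mul_pow]
  calc R'⁻¹ ^ n * |iteratedDeriv n (stepFn s) ((t - τ) / R')|
      ≤ R'⁻¹ ^ n * (A * a ^ n * (n.factorial : ℝ) ^ s) := by gcongr; exact h n _
    _ = _ := by ring

/-! ### The flat output -/

theorem scaledStep_eq_zero {s τ R' t : ℝ} (hR : 0 < R') (ht : τ + R' ≤ t) :
    stepFn s ((t - τ) / R') = 0 := by
  apply stepFn_of_one_le
  rw [le_div_iff₀ hR]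
  linarith

/-- Before τ + R' one has |t-τ| < τ, so the Taylor series sums to the free output. From τ + R' on
the step function is 0, and the value given to the possibly divergent series is immaterial. -/
theorem flatOutput_eq {τ R' s : ℝ} (hR : 0 < R') (hRτ : R' < τ) (θ₀ : L2)
    {t : ℝ} (ht : 0 < t) :
    flatOutput τ R' s θ₀ t = stepFn s ((t - τ) / R') * freeOutput θ₀ t := by
  rw [flatOutput]
  rcases le_or_gt (τ + R') t with h | h
  · rw [scaledStep_eq_zero hR h, zero_mul, zero_mul]
  · have h2 : |t - τ| < τ := abs_lt.2 ⟨by linarith, by linarith⟩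
    rw [(hasSum_freeOutput_taylor θ₀ h2).2.tsum_eq, add_sub_cancel]

theorem flatOutput_eventuallyEq {τ R' s : ℝ} (hR : 0 < R') (hRτ : R' < τ) (θ₀ : L2)
    {t : ℝ} (ht : 0 < t) :
    flatOutput τ R' s θ₀ =ᶠ[𝓝 t] fun t => stepFn s ((t - τ) / R') * freeOutput θ₀ t := by
  filter_upwards [Ioi_mem_nhds ht] with x hx
  exact flatOutput_eq hR hRτ θ₀ hx

theorem contDiffAt_flatOutput {τ R' s : ℝ} (hs1 : 1 < s) (hs2 : s < 2) (hR : 0 < R')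
    (hRτ : R' < τ) (θ₀ : L2) {t : ℝ} (ht : 0 < t) :
    ContDiffAt ℝ (⊤ : ℕ∞) (flatOutput τ R' s θ₀) t :=
  ((contDiff_scaledStep hs1 hs2 τ R').contDiffAt.mul
    (contDiffAt_freeOutput θ₀ ht)).congr_of_eventuallyEq (flatOutput_eventuallyEq hR hRτ θ₀ ht)

theorem contDiff_flatOutputBar {s : ℝ} (hs1 : 1 < s) (hs2 : s < 2) (τ R' : ℝ)
    (θ₀ : L2) (K N : ℕ) : ContDiff ℝ (⊤ : ℕ∞) (flatOutputBar τ R' s θ₀ K N) := by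
  refine (contDiff_scaledStep hs1 hs2 τ R').mul ?_
  fun_prop

theorem tsum_heatDecay_nonneg (t : ℝ) : 0 ≤ ∑' k, heatDecay t k :=
  tsum_nonneg fun k => (heatDecay_pos t k).le

/-- The flat output is Gevrey of order `s` on `[δ, ∞)`, uniformly in the initial state. -/
theorem exists_gevrey_flatOutput {τ R' s δ : ℝ} (hs1 : 1 < s) (hs2 : s < 2) (hR : 0 < R')
    (hRτ : R' < τ) (hδ : 0 < δ) : ∃ M ρ : ℝ, 0 ≤ M ∧ 0 < ρ ∧ ∀ (θ₀ : L2) (t : ℝ), δ ≤ t →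
      ∀ n : ℕ, |iteratedDeriv n (flatOutput τ R' s θ₀) t| ≤
        M * ‖θ₀‖ * ρ ^ n * (n.factorial : ℝ) ^ s := by
  obtain ⟨A, a, hA, ha, h⟩ := exists_gevrey_scaledStep hs1 hs2 τ hR
  have hS := tsum_heatDecay_nonneg (δ / 2)
  refine ⟨A * (2 * ∑' k, heatDecay (δ / 2) k), a + (δ / 2)⁻¹, by positivity, by positivity,
    fun θ₀ t ht n => ?_⟩
  have ht0 := hδ.trans_le ht
  rw [(flatOutput_eventuallyEq hR hRτ θ₀ ht0).iteratedDeriv_eq]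
  refine (gevrey_mul hs1.le hA.le ha.le (half_pos hδ) (by positivity)
    (contDiff_scaledStep hs1 hs2 τ R').contDiffAt (contDiffAt_freeOutput θ₀ ht0)
    (fun n => h n t) (abs_iteratedDeriv_freeOutput_le θ₀ hδ ht) n).trans (le_of_eq ?_)
  ring

/-! ### The truncated flat output -/

/-- The holomorphic extension of the truncated series in the flat output, without the factor
`√2`. -/
noncomputable def truncSum (c : ℕ → ℝ) (τ : ℝ) (K N : ℕ) (z : ℂ) : ℂ :=
  ∑ n ∈ Finset.range (N + 1), ((c n * heatDecay τ n : ℝ) : ℂ) *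
    ∑ k ∈ Finset.range (K + 1), (-((n : ℂ) * Real.pi) ^ 2 * (z - τ)) ^ k / (k.factorial : ℂ)

/-- Exchanging the finite sums shows the double truncation as follows: keep the modes n ≤ N, and in
each replace e^{-n²π²(t-τ)} by its Taylor polynomial of degree K. -/
theorem flatOutputBar_eq (τ R' s : ℝ) (θ₀ : L2) (K N : ℕ) (t : ℝ) :
    flatOutputBar τ R' s θ₀ K N t = stepFn s ((t - τ) / R') *
      ((Real.sqrt 2 : ℂ) * truncSum (cosCoeff θ₀) τ K N t).re := by
  have e : (Real.sqrt 2 : ℂ) * truncSum (cosCoeff θ₀) τ K N t =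
      ((∑ k ∈ Finset.range (K + 1), yCoeffBar τ θ₀ N k * (t - τ) ^ k / (k.factorial : ℝ) : ℝ) :
        ℂ) := by
    have h1 : ∀ k : ℕ, yCoeffBar τ θ₀ N k * (t - τ) ^ k / (k.factorial : ℝ) =
        ∑ n ∈ Finset.range (N + 1), Real.sqrt 2 * ((cosCoeff θ₀ n * heatDecay τ n) *
          ((-((n : ℝ) * Real.pi) ^ 2 * (t - τ)) ^ k / (k.factorial : ℝ))) := by
      intro k
      rw [yCoeffBar, Finset.mul_sum, Finset.sum_mul, Finset.sum_mul, Finset.sum_div]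
      refine Finset.sum_congr rfl fun n _ => ?_
      rw [yTerm_eq, show (-((n : ℝ) * Real.pi) ^ 2 * (t - τ)) ^ k =
        (n : ℝ) ^ (2 * k) * (-Real.pi ^ 2) ^ k * (t - τ) ^ k by
          rw [pow_mul, ← mul_pow, ← mul_pow]; congr 1; ring]
      ring
    simp_rw [h1]
    rw [Finset.sum_comm, truncSum, Finset.mul_sum]
    push_cast
    refine Finset.sum_congr rfl fun n _ => ?_
    rw [Finset.mul_sum, Finset.mul_sum]
  rw [flatOutputBar, e, Complex.ofReal_re]

theorem expTerm_eq (c : ℕ → ℝ) (n : ℕ) (τ : ℝ) (z : ℂ) :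
    expTerm c n z = ((c n * heatDecay τ n : ℝ) : ℂ) *
      Complex.exp (-((n : ℂ) * Real.pi) ^ 2 * (z - τ)) := by
  unfold expTerm heatDecay
  push_cast
  rw [mul_assoc (c n : ℂ) (Complex.exp _), ← Complex.exp_add]
  congr 2
  ring

/-- The partial sum over n ≤ N is interposed. The first difference is a tail on Re z ≥ τ - r; the
second is a sum of exponential remainders, where e^{l n²π² r} is absorbed by e^{-n²π²τ} since lr <
τ. -/
theorem norm_expSum_sub_truncSum_le {c : ℕ → ℝ} {B : ℝ} (hc : ∀ n, |c n| ≤ B) {τ r l : ℝ}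
    (hrτ : r < τ) (hl : 1 ≤ l) (hlr : l * r < τ) (K N : ℕ) {z : ℂ} (hz : ‖z - τ‖ ≤ r) :
    ‖expSum c z - truncSum c τ K N z‖ ≤
      B * ((heatDecay ((τ - r) / 2) N * ∑' n, heatDecay ((τ - r) / 2) n) +
        l⁻¹ ^ K * ∑' n, heatDecay (τ - l * r) n) := by
  have hB := (abs_nonneg _).trans (hc 0)
  have hre : τ - r ≤ z.re := re_ge_of_mem_closedBall (by simpa [dist_eq_norm] using hz)
  have h1 := norm_expSum_sub_sum_le hc (sub_pos.2 hrτ) hre N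
  have h2 : ‖(∑ n ∈ Finset.range (N + 1), expTerm c n z) - truncSum c τ K N z‖ ≤
      B * (l⁻¹ ^ K * ∑' n, heatDecay (τ - l * r) n) := by
    rw [truncSum, ← Finset.sum_sub_distrib]
    calc _ ≤ ∑ n ∈ Finset.range (N + 1), B * l⁻¹ ^ K * heatDecay (τ - l * r) n := by
          refine norm_sum_le_of_le _ fun n _ => ?_
          rw [expTerm_eq c n τ z, ← mul_sub, norm_mul, Complex.norm_real, norm_mul,
            Real.norm_eq_abs, Real.norm_of_nonneg (heatDecay_pos τ n).le]
          have h3 := norm_exp_sub_sum_le hl (-((n : ℂ) * Real.pi) ^ 2 * (z - τ)) K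
          have h4 : l * ‖-((n : ℂ) * Real.pi) ^ 2 * (z - τ)‖ ≤ -((n * Real.pi) ^ 2) * (-(l * r)) := by
            rw [norm_mul, norm_neg, norm_pow, norm_mul, Complex.norm_real, Complex.norm_natCast,
              Real.norm_of_nonneg Real.pi_pos.le]
            calc l * ((n * Real.pi) ^ 2 * ‖z - τ‖) ≤ l * ((n * Real.pi) ^ 2 * r) := by gcongr
              _ = _ := by ring
          have h5 : heatDecay τ n * Real.exp (-((n * Real.pi) ^ 2) * (-(l * r))) =
              heatDecay (τ - l * r) n := heatDecay_mul_exp τ (-(l * r)) n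
          have h6 := (heatDecay_pos τ n).le
          have h7 : 0 ≤ l⁻¹ ^ K := by positivity
          calc |c n| * heatDecay τ n * _
              ≤ B * heatDecay τ n * (l⁻¹ ^ K * Real.exp (-((n * Real.pi) ^ 2) * (-(l * r)))) := by
                refine mul_le_mul (mul_le_mul_of_nonneg_right (hc n) h6)
                  (h3.trans (mul_le_mul_of_nonneg_left (Real.exp_le_exp.2 h4) h7))
                  (norm_nonneg _) (mul_nonneg hB h6)
            _ = B * l⁻¹ ^ K * heatDecay (τ - l * r) n := by rw [← h5]; ring
      _ = B * l⁻¹ ^ K * ∑ n ∈ Finset.range (N + 1), heatDecay (τ - l * r) n :=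
          (Finset.mul_sum _ _ _).symm
      _ ≤ B * l⁻¹ ^ K * ∑' n, heatDecay (τ - l * r) n := by
          refine mul_le_mul_of_nonneg_left ?_ (by positivity)
          exact (summable_heatDecay (sub_pos.2 hlr)).sum_le_tsum _
            fun n _ => (heatDecay_pos _ n).le
      _ = _ := by ring
  calc _ = ‖(expSum c z - ∑ n ∈ Finset.range (N + 1), expTerm c n z) +
        ((∑ n ∈ Finset.range (N + 1), expTerm c n z) - truncSum c τ K N z)‖ := by
        rw [sub_add_sub_cancel]
    _ ≤ _ := (norm_add_le _ _).trans (add_le_add h1 h2)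
    _ = _ := by ring

/-- The error of the truncated flat output is Gevrey of order `s`, with a constant that decays
exponentially in the orders of truncation. -/
theorem exists_gevrey_flatOutput_sub {τ R' s : ℝ} (hs1 : 1 < s) (hs2 : s < 2) (hR : 0 < R')
    (hRτ : R' < τ) : ∃ M ρ C₂ C₃ : ℝ, 0 ≤ M ∧ 0 < ρ ∧ 0 < C₂ ∧ 0 < C₃ ∧
      ∀ (θ₀ : L2) (K N : ℕ) (t : ℝ), τ ≤ t → ∀ n : ℕ,
        |iteratedDeriv n (flatOutput τ R' s θ₀) t -
          iteratedDeriv n (flatOutputBar τ R' s θ₀ K N) t| ≤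
        M * (Real.exp (-C₂ * K) + Real.exp (-C₃ * (N : ℝ) ^ 2)) * ‖θ₀‖ * ρ ^ n *
          (n.factorial : ℝ) ^ s := by
  obtain ⟨A, a, hA, ha, h⟩ := exists_gevrey_scaledStep hs1 hs2 τ hR
  have hτ : 0 < τ := hR.trans hRτ
  -- For t in [τ, τ+R'] the disc of radius r - R' about t lies in the disc of radius r < τ about τ;
  -- this leaves room for Cauchy's estimate.
  set r : ℝ := (R' + τ) / 2 with hr
  have hrR : R' < r := by rw [hr]; linarith
  have hrτ : r < τ := by rw [hr]; linarith
  have hr0 : 0 < r := hR.trans hrR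
  -- Chosen so that l > 1 and lr < τ both follow from r < τ; ln l becomes C₂.
  set l : ℝ := 2 * τ / (r + τ) with hl
  have hl1 : 1 < l := by rw [hl, lt_div_iff₀ (by positivity)]; linarith
  have hlr : l * r < τ := by
    rw [hl, div_mul_eq_mul_div, div_lt_iff₀ (by positivity)]; nlinarith
  set S₁ := ∑' n, heatDecay ((τ - r) / 2) n with hS₁
  set S₂ := ∑' n, heatDecay (τ - l * r) n with hS₂
  have hS₁0 : 0 ≤ S₁ := tsum_heatDecay_nonneg _
  have hS₂0 : 0 ≤ S₂ := tsum_heatDecay_nonneg _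
  have hd : 0 < r - R' := sub_pos.2 hrR
  refine ⟨A * (2 * (S₁ + S₂)), a + (r - R')⁻¹, Real.log l, Real.pi ^ 2 * ((τ - r) / 2),
    by positivity, by positivity, Real.log_pos hl1,
    mul_pos (by positivity) (by linarith), fun θ₀ K N t ht n => ?_⟩
  -- Beyond τ + R' the discs about t could leave the disc about τ, but there both outputs vanish
  -- near t.
  rcases lt_or_ge (τ + R') t with hlt | hle
  · have hz1 : flatOutput τ R' s θ₀ =ᶠ[𝓝 t] fun _ => 0 := by
      filter_upwards [Ioi_mem_nhds hlt] with x hx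
      rw [flatOutput, scaledStep_eq_zero hR (le_of_lt hx), zero_mul]
    have hz2 : flatOutputBar τ R' s θ₀ K N =ᶠ[𝓝 t] fun _ => 0 := by
      filter_upwards [Ioi_mem_nhds hlt] with x hx
      rw [flatOutputBar, scaledStep_eq_zero hR (le_of_lt hx), zero_mul]
    rw [hz1.iteratedDeriv_eq, hz2.iteratedDeriv_eq, sub_self, abs_zero]
    positivity
  have ht0 : 0 < t := hτ.trans_le ht
  have hn : ((n : ℕ∞) : WithTop ℕ∞) ≤ ((⊤ : ℕ∞) : WithTop ℕ∞) := by exact_mod_cast le_top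
  set E : ℂ → ℂ := fun z =>
    (Real.sqrt 2 : ℂ) * (expSum (cosCoeff θ₀) z - truncSum (cosCoeff θ₀) τ K N z) with hE
  set e : ℝ → ℝ := fun x => (E x).re with he
  have hEd : DifferentiableOn ℂ E {z | 0 < z.re} := by
    refine ((differentiableOn_expSum (abs_cosCoeff_le θ₀)).sub ?_).const_mul _
    unfold truncSum
    fun_prop
  have hev : (fun x => flatOutput τ R' s θ₀ x - flatOutputBar τ R' s θ₀ K N x) =ᶠ[𝓝 t]
      fun x => stepFn s ((x - τ) / R') * e x := by
    filter_upwards [Ioi_mem_nhds ht0] with x hx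
    rw [flatOutput_eq hR hRτ θ₀ hx, flatOutputBar_eq, freeOutput_eq_re, he, hE]
    simp only
    rw [mul_sub (Real.sqrt 2 : ℂ), Complex.sub_re]
    ring
  rw [← iteratedDeriv_fun_sub ((contDiffAt_flatOutput hs1 hs2 hR hRτ θ₀ ht0).of_le hn)
    ((contDiff_flatOutputBar hs1 hs2 τ R' θ₀ K N).contDiffAt.of_le hn), hev.iteratedDeriv_eq]
  set D : ℝ := Real.exp (-Real.log l * K) +
    Real.exp (-(Real.pi ^ 2 * ((τ - r) / 2)) * (N : ℝ) ^ 2) with hD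
  have hball : ∀ z ∈ Metric.closedBall (t : ℂ) (r - R'), ‖z - τ‖ ≤ r := by
    intro z hz
    have h1 : ‖z - t‖ ≤ r - R' := by simpa [dist_eq_norm] using hz
    have h2 : ‖(t : ℂ) - τ‖ ≤ R' := by
      rw [← Complex.ofReal_sub, Complex.norm_real, Real.norm_of_nonneg (by linarith)]
      linarith
    calc ‖z - τ‖ = ‖(z - t) + (t - τ)‖ := by rw [sub_add_sub_cancel]
      _ ≤ (r - R') + R' := (norm_add_le _ _).trans (add_le_add h1 h2)
      _ = r := by ring
  have hEb : ∀ z ∈ Metric.closedBall (t : ℂ) (r - R'), ‖E z‖ ≤ 2 * (S₁ + S₂) * D * ‖θ₀‖ := by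
    intro z hz
    have h1 := norm_expSum_sub_truncSum_le (abs_cosCoeff_le θ₀) hrτ hl1.le hlr K N (hball z hz)
    rw [← hS₁, ← hS₂] at h1
    have h2 : heatDecay ((τ - r) / 2) N =
        Real.exp (-(Real.pi ^ 2 * ((τ - r) / 2)) * (N : ℝ) ^ 2) := by
      unfold heatDecay; congr 1; ring
    have h3 : l⁻¹ ^ K = Real.exp (-Real.log l * K) := by
      rw [Real.exp_mul, Real.exp_neg, Real.exp_log (by linarith), Real.rpow_natCast]
    rw [h2, h3] at h1
    rw [hE, norm_mul, Complex.norm_real, Real.norm_of_nonneg (Real.sqrt_nonneg 2)]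
    set u := Real.exp (-Real.log l * K)
    set v := Real.exp (-(Real.pi ^ 2 * ((τ - r) / 2)) * (N : ℝ) ^ 2)
    have hu : 0 < u := Real.exp_pos _
    have hv : 0 < v := Real.exp_pos _
    calc Real.sqrt 2 * _ ≤ Real.sqrt 2 * (Real.sqrt 2 * ‖θ₀‖ * (v * S₁ + u * S₂)) := by gcongr
      _ = (Real.sqrt 2 * Real.sqrt 2) * ‖θ₀‖ * (v * S₁ + u * S₂) := by ring
      _ = 2 * ‖θ₀‖ * (v * S₁ + u * S₂) := by rw [Real.mul_self_sqrt (by norm_num)]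
      _ ≤ 2 * ‖θ₀‖ * ((v + u) * S₁ + (v + u) * S₂) := by
        gcongr <;> linarith
      _ = 2 * (S₁ + S₂) * D * ‖θ₀‖ := by rw [hD]; ring
  have hsub : Metric.closedBall (t : ℂ) (r - R') ⊆ {z | 0 < z.re} := by
    intro z hz
    have := re_ge_of_mem_closedBall hz
    show 0 < z.re
    linarith
  have hD0 : 0 ≤ D := by positivity
  refine (gevrey_mul (M := 2 * (S₁ + S₂) * D * ‖θ₀‖) hs1.le hA.le ha.le hd (by positivity)
    (contDiff_scaledStep hs1 hs2 τ R').contDiffAt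
    (contDiffAt_of_holomorphic isOpen_re_pos hEd (fun x _ => rfl) (by simpa using ht0))
    (fun n => h n t) (fun n => ?_) n).trans (le_of_eq ?_)
  · exact abs_iteratedDeriv_le_of_holomorphic isOpen_re_pos hEd (fun x _ => rfl) hd hsub hEb n
  · ring

/-! ### Series in the derivatives of a flat output -/

theorem contDiffAt_iteratedDeriv {y : ℝ → ℝ} {t : ℝ} (hy : ContDiffAt ℝ (⊤ : ℕ∞) y t) (i : ℕ) :
    ContDiffAt ℝ (⊤ : ℕ∞) (iteratedDeriv i y) t := by
  induction i with
  | zero => simpa using hy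
  | succ i ih =>
    rw [iteratedDeriv_succ]
    exact ih.derivWithin (by simp)

theorem hasDerivAt_iteratedDeriv {y : ℝ → ℝ} {t : ℝ} (hy : ContDiffAt ℝ (⊤ : ℕ∞) y t) (i : ℕ) :
    HasDerivAt (iteratedDeriv i y) (iteratedDeriv (i + 1) y t) t := by
  rw [iteratedDeriv_succ]
  exact ((contDiffAt_iteratedDeriv hy i).differentiableAt (by simp)).hasDerivAt

/-- `y` is smooth on `(0, ∞)`, and locally uniformly there its derivatives are small enough for
`∑ y^{(i)} x^{2i} / (2i)!` and its derivatives to converge normally for `|x| ≤ 2`. -/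
structure FlatlyBounded (y : ℝ → ℝ) : Prop where
  smooth : ∀ t, 0 < t → ContDiffAt ℝ (⊤ : ℕ∞) y t
  bound : ∀ δ, 0 < δ → ∃ u : ℕ → ℝ, Summable u ∧ ∀ t, δ ≤ t → ∀ i : ℕ,
    |iteratedDeriv i y t| * 4 ^ i / ((2 * i).factorial : ℝ) ≤ u i ∧
    |iteratedDeriv (i + 1) y t| * (2 * 4 ^ i) / ((2 * i).factorial : ℝ) ≤ u i

theorem FlatlyBounded.of_gevrey {y : ℝ → ℝ} {s : ℝ} (hs2 : s < 2)
    (hy : ∀ t, 0 < t → ContDiffAt ℝ (⊤ : ℕ∞) y t)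
    (hb : ∀ δ, 0 < δ → ∃ M ρ : ℝ, 0 ≤ M ∧ 0 < ρ ∧ ∀ t, δ ≤ t → ∀ n : ℕ,
      |iteratedDeriv n y t| ≤ M * ρ ^ n * (n.factorial : ℝ) ^ s) : FlatlyBounded y := by
  refine ⟨hy, fun δ hδ => ?_⟩
  obtain ⟨M, ρ, hM, hρ, h⟩ := hb δ hδ
  -- Allowing |x| ≤ 2 multiplies the rate by 2²; the shift of the derivative index costs a further
  -- factor 4.
  refine ⟨fun i => M * gevreyWeight s (ρ * 2 ^ 2) i + 2 * M * ρ * gevreyWeight s (4 * ρ * 2 ^ 2) i,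
    ((summable_gevreyWeight hs2 (by positivity)).mul_left _).add
      ((summable_gevreyWeight hs2 (by positivity)).mul_left _), fun t ht i => ⟨?_, ?_⟩⟩
  · refine le_add_of_le_of_nonneg ?_
      (mul_nonneg (by positivity) (gevreyWeight_nonneg (by positivity) i))
    rw [← gevreyWeight_mul_pow, pow_mul, gevreyWeight]
    calc |iteratedDeriv i y t| * 4 ^ i / ((2 * i).factorial : ℝ)
        ≤ M * ρ ^ i * (i.factorial : ℝ) ^ s * 4 ^ i / ((2 * i).factorial : ℝ) := by
          gcongr; exact h t ht i
      _ = _ := by norm_num; ring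
  · refine le_add_of_nonneg_of_le (mul_nonneg hM (gevreyWeight_nonneg (by positivity) i)) ?_
    rw [← gevreyWeight_mul_pow, pow_mul]
    have h1 := pow_succ_mul_factorial_le hs2.le hρ i
    calc |iteratedDeriv (i + 1) y t| * (2 * 4 ^ i) / ((2 * i).factorial : ℝ)
        ≤ M * ρ ^ (i + 1) * ((i + 1).factorial : ℝ) ^ s * (2 * 4 ^ i) /
            ((2 * i).factorial : ℝ) := by
          gcongr; exact h t ht (i + 1)
      _ = 2 * M * 4 ^ i *
          (ρ ^ (i + 1) * ((i + 1).factorial : ℝ) ^ s / ((2 * i).factorial : ℝ)) := by ring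
      _ ≤ 2 * M * 4 ^ i * (ρ * gevreyWeight s (4 * ρ) i) := by gcongr
      _ = _ := by norm_num; ring

/-- The term `y^{(i)}(t) x^{2i} / (2i)!`. -/
noncomputable def flatTerm (y : ℝ → ℝ) (i : ℕ) (t x : ℝ) : ℝ :=
  iteratedDeriv i y t * x ^ (2 * i) / ((2 * i).factorial : ℝ)

/-- The term `y^{(i+1)}(t) x^{2i+1} / (2i+1)!` of the space derivative. -/
noncomputable def flatTermX (y : ℝ → ℝ) (i : ℕ) (t x : ℝ) : ℝ :=
  iteratedDeriv (i + 1) y t * x ^ (2 * i + 1) / ((2 * i + 1).factorial : ℝ)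

/-- The term `y^{(i+1)}(t) x^{2i} / (2i)!` of the time derivative. -/
noncomputable def flatTermT (y : ℝ → ℝ) (i : ℕ) (t x : ℝ) : ℝ :=
  iteratedDeriv (i + 1) y t * x ^ (2 * i) / ((2 * i).factorial : ℝ)

theorem abs_pow_le_of_abs_le_two {x : ℝ} (hx : |x| ≤ 2) (i : ℕ) : |x| ^ (2 * i) ≤ 4 ^ i := by
  rw [pow_mul]
  gcongr
  nlinarith [abs_nonneg x]

theorem abs_flatTerm_le (y : ℝ → ℝ) {t x : ℝ} (hx : |x| ≤ 2) (i : ℕ) :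
    |flatTerm y i t x| ≤ |iteratedDeriv i y t| * 4 ^ i / ((2 * i).factorial : ℝ) := by
  rw [flatTerm, abs_div, abs_mul, abs_pow, Nat.abs_cast]
  gcongr
  exact abs_pow_le_of_abs_le_two hx i

theorem abs_flatTermT_le (y : ℝ → ℝ) {t x : ℝ} (hx : |x| ≤ 2) (i : ℕ) :
    |flatTermT y i t x| ≤
      |iteratedDeriv (i + 1) y t| * (2 * 4 ^ i) / ((2 * i).factorial : ℝ) := by
  rw [flatTermT, abs_div, abs_mul, abs_pow, Nat.abs_cast]
  gcongr
  have := abs_pow_le_of_abs_le_two hx i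
  have : (0 : ℝ) < 4 ^ i := by positivity
  linarith

/-- The odd power |x|^{2i+1} accounts for the factor 2 in the second bound of `FlatlyBounded`;
weakening (2i+1)! to (2i)! lets one sequence dominate both derivative series. -/
theorem abs_flatTermX_le (y : ℝ → ℝ) {t x : ℝ} (hx : |x| ≤ 2) (i : ℕ) :
    |flatTermX y i t x| ≤
      |iteratedDeriv (i + 1) y t| * (2 * 4 ^ i) / ((2 * i).factorial : ℝ) := by
  rw [flatTermX, abs_div, abs_mul, abs_pow, Nat.abs_cast]
  gcongr
  · rw [pow_succ, mul_comm]
    exact mul_le_mul hx (abs_pow_le_of_abs_le_two hx i) (by positivity) (by norm_num)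
  · omega

variable {y : ℝ → ℝ}

theorem FlatlyBounded.summable_flatTerm (hy : FlatlyBounded y) {t x : ℝ} (ht : 0 < t)
    (hx : |x| ≤ 2) : Summable fun i => flatTerm y i t x := by
  obtain ⟨u, hu, h⟩ := hy.bound t ht
  exact Summable.of_norm_bounded hu fun i => (abs_flatTerm_le y hx i).trans (h t le_rfl i).1

theorem FlatlyBounded.summable_flatTermX (hy : FlatlyBounded y) {t x : ℝ} (ht : 0 < t)
    (hx : |x| ≤ 2) : Summable fun i => flatTermX y i t x := by
  obtain ⟨u, hu, h⟩ := hy.bound t ht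
  exact Summable.of_norm_bounded hu fun i => (abs_flatTermX_le y hx i).trans (h t le_rfl i).2

theorem FlatlyBounded.hasDerivAt_tsum_flatTermX (hy : FlatlyBounded y) {t x : ℝ} (ht : 0 < t)
    (hx : |x| < 2) :
    HasDerivAt (fun x => ∑' i, flatTermX y i t x) (∑' i, flatTermT y i t x) x := by
  obtain ⟨u, hu, h⟩ := hy.bound t ht
  have habs : ∀ z ∈ Set.Ioo (-2 : ℝ) 2, |z| ≤ 2 := fun z hz => (abs_lt.2 hz).le
  refine hasDerivAt_tsum_of_isPreconnected (g := fun i x => flatTermX y i t x)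
    (g' := fun i x => flatTermT y i t x) (t := Set.Ioo (-2) 2) (y₀ := 0)
    hu isOpen_Ioo isPreconnected_Ioo (fun i z _ => ?_)
    (fun i z hz => (abs_flatTermT_le y (habs z hz) i).trans (h t le_rfl i).2)
    (by simp) (hy.summable_flatTermX ht (by simp)) (abs_lt.1 hx)
  have hd := ((hasDerivAt_pow (2 * i + 1) z).const_mul (iteratedDeriv (i + 1) y t)).div_const
    ((2 * i + 1).factorial : ℝ)
  refine hd.congr_deriv ?_
  rw [flatTermT, Nat.factorial_succ, Nat.add_sub_cancel]
  push_cast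
  field_simp

theorem FlatlyBounded.hasDerivAt_tsum_flatTerm (hy : FlatlyBounded y) {t x : ℝ} (ht : 0 < t)
    (hx : |x| < 2) :
    HasDerivAt (fun x => ∑' i, flatTerm y i t x) (∑' i, flatTermX y i t x) x := by
  obtain ⟨u, hu, h⟩ := hy.bound t ht
  have habs : ∀ z ∈ Set.Ioo (-2 : ℝ) 2, |z| ≤ 2 := fun z hz => (abs_lt.2 hz).le
  -- The term i = 0 is constant in x. Without it, the x-derivative of term i+1 is exactly
  -- `flatTermX` of index i.
  have hshift : ∀ z, |z| ≤ 2 → ∑' i, flatTerm y i t z = y t + ∑' i, flatTerm y (i + 1) t z := by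
    intro z hz
    rw [(hy.summable_flatTerm ht hz).tsum_eq_zero_add]
    simp [flatTerm]
  have hd : HasDerivAt (fun x => y t + ∑' i, flatTerm y (i + 1) t x)
      (∑' i, flatTermX y i t x) x := by
    refine HasDerivAt.const_add _ ?_
    refine hasDerivAt_tsum_of_isPreconnected (g := fun i x => flatTerm y (i + 1) t x)
      (g' := fun i x => flatTermX y i t x) (t := Set.Ioo (-2) 2) (y₀ := 0)
      hu isOpen_Ioo isPreconnected_Ioo (fun i z _ => ?_)
      (fun i z hz => (abs_flatTermX_le y (habs z hz) i).trans (h t le_rfl i).2)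
      (by simp) ?_ (abs_lt.1 hx)
    · have hd := ((hasDerivAt_pow (2 * (i + 1)) z).const_mul (iteratedDeriv (i + 1) y t)).div_const
        ((2 * (i + 1)).factorial : ℝ)
      refine hd.congr_deriv ?_
      rw [flatTermX, show 2 * (i + 1) = (2 * i + 1) + 1 by ring, Nat.factorial_succ,
        Nat.add_sub_cancel]
      push_cast
      field_simp
    · exact (summable_nat_add_iff 1).2 (hy.summable_flatTerm (x := 0) ht (by simp))
  refine hd.congr_of_eventuallyEq ?_
  filter_upwards [Ioo_mem_nhds (abs_lt.1 hx).1 (abs_lt.1 hx).2] with z hz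
  exact hshift z (habs z hz)

/-- The heat equation: the derivative in time is the same series `flatTermT` as the second
derivative in x. -/
theorem FlatlyBounded.hasDerivAt_time (hy : FlatlyBounded y) {t x : ℝ} (ht : 0 < t)
    (hx : |x| ≤ 2) :
    HasDerivAt (fun r => ∑' i, flatTerm y i r x) (∑' i, flatTermT y i t x) t := by
  obtain ⟨u, hu, h⟩ := hy.bound (t / 2) (half_pos ht)
  have hmem : t ∈ Set.Ioi (t / 2) := by simpa using ht
  refine hasDerivAt_tsum_of_isPreconnected (g := fun i r => flatTerm y i r x)
    (g' := fun i r => flatTermT y i r x) (t := Set.Ioi (t / 2)) (y₀ := t)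
    hu isOpen_Ioi isPreconnected_Ioi (fun i r hr => ?_)
    (fun i r hr => (abs_flatTermT_le y hx i).trans (h r (le_of_lt hr) i).2)
    hmem (hy.summable_flatTerm ht hx) hmem
  have hr0 : 0 < r := (half_pos ht).trans hr
  exact ((hasDerivAt_iteratedDeriv (hy.smooth r hr0) i).mul_const _).div_const _

theorem continuousOn_tsum_of_flat (hy : FlatlyBounded y) {f : ℕ → ℝ → ℝ → ℝ}
    (hf : ∀ i, ∀ t x, 0 < t → ContinuousAt (Function.uncurry (f i)) (t, x))
    (hb : ∀ i t x, |x| ≤ 2 →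
      |f i t x| ≤ |iteratedDeriv i y t| * 4 ^ i / ((2 * i).factorial : ℝ) ∨
      |f i t x| ≤ |iteratedDeriv (i + 1) y t| * (2 * 4 ^ i) / ((2 * i).factorial : ℝ)) (T : ℝ) :
    ContinuousOn (Function.uncurry fun t x => ∑' i, f i t x) (Set.Ioc 0 T ×ˢ Set.Icc 0 1) := by
  rintro ⟨t, x⟩ ⟨ht, hx⟩
  have ht0 : 0 < t := ht.1
  obtain ⟨u, hu, h⟩ := hy.bound (t / 2) (half_pos ht0)
  have hc : ContinuousOn (fun p : ℝ × ℝ => ∑' i, f i p.1 p.2)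
      (Set.Ioi (t / 2) ×ˢ Set.Ioo (-2) 2) := by
    refine continuousOn_tsum (fun i => ?_) hu fun i p hp => ?_
    · rintro ⟨r, z⟩ ⟨hr, -⟩
      exact (hf i r z ((half_pos ht0).trans hr)).continuousWithinAt
    · have hp2 : |p.2| ≤ 2 := (abs_lt.2 hp.2).le
      rcases hb i p.1 p.2 hp2 with h1 | h1
      · exact h1.trans (h p.1 (le_of_lt hp.1) i).1
      · exact h1.trans (h p.1 (le_of_lt hp.1) i).2
  refine (hc.continuousAt ((isOpen_Ioi.prod isOpen_Ioo).mem_nhds ⟨?_, ?_⟩)).continuousWithinAt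
  · simpa using ht0
  · exact ⟨by linarith [hx.1], by linarith [hx.2]⟩

theorem continuousAt_iteratedDeriv_mul_pow (hy : FlatlyBounded y) (i k : ℕ) (d : ℝ) {t x : ℝ}
    (ht : 0 < t) :
    ContinuousAt (Function.uncurry fun t x => iteratedDeriv i y t * x ^ k / d) (t, x) := by
  have h1 : ContinuousAt (fun p : ℝ × ℝ => iteratedDeriv i y p.1) (t, x) :=
    ContinuousAt.comp (g := iteratedDeriv i y) (f := Prod.fst) (x := (t, x))
      (hasDerivAt_iteratedDeriv (hy.smooth t ht) i).continuousAt continuousAt_fst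
  exact (h1.mul (continuousAt_snd.pow k)).div_const d

/-! ### The cosine basis of `L²(0,1)` -/

/-- The normalization of `cos(nπx)` in `L²(0,1)`. -/
noncomputable def cosNorm (n : ℕ) : ℝ := if n = 0 then 1 else Real.sqrt 2

/-- The normalized cosine as a bounded continuous function. -/
noncomputable def cosFun (n : ℕ) : BoundedContinuousFunction ℝ ℝ :=
  BoundedContinuousFunction.ofNormedAddCommGroup (fun x => cosNorm n * Real.cos (n * Real.pi * x))
    (by fun_prop) |cosNorm n| fun x => by
      rw [norm_mul, Real.norm_eq_abs, Real.norm_eq_abs]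
      exact mul_le_of_le_one_right (abs_nonneg _) (Real.abs_cos_le_one _)

theorem cosFun_apply (n : ℕ) (x : ℝ) : cosFun n x = cosNorm n * Real.cos (n * Real.pi * x) := rfl

theorem cosNorm_pos (n : ℕ) : 0 < cosNorm n := by
  unfold cosNorm; split_ifs <;> positivity

theorem cosNorm_le (n : ℕ) : cosNorm n ≤ 2 := by
  unfold cosNorm
  split_ifs
  · norm_num
  · rw [Real.sqrt_le_left (by norm_num)]; norm_num

theorem norm_cosFun_le (n : ℕ) : ‖cosFun n‖ ≤ 2 := by
  refine (BoundedContinuousFunction.norm_ofNormedAddCommGroup_le _ (abs_nonneg _) _).trans ?_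
  rw [abs_of_pos (cosNorm_pos n)]
  exact cosNorm_le n

/-- The inclusion of bounded continuous functions in `L²(0,1)`. -/
noncomputable abbrev toL2 : BoundedContinuousFunction ℝ ℝ →L[ℝ] L2 :=
  BoundedContinuousFunction.toLp 2 unitMeasure ℝ

theorem coeFn_toL2 (f : BoundedContinuousFunction ℝ ℝ) : toL2 f =ᵐ[unitMeasure] f :=
  BoundedContinuousFunction.coeFn_toLp 2 unitMeasure ℝ f

theorem integral_cos_int_mul_pi (k : ℤ) :
    ∫ x, Real.cos (k * Real.pi * x) ∂unitMeasure = if k = 0 then 1 else 0 := by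
  rw [← integral_Ioc_eq_integral_Ioo, ← intervalIntegral.integral_of_le zero_le_one]
  split_ifs with h
  · simp [h]
  · have hk : (k * Real.pi : ℝ) ≠ 0 := mul_ne_zero (by exact_mod_cast h) Real.pi_ne_zero
    rw [intervalIntegral.integral_comp_mul_left (fun x => Real.cos x) hk]
    simp [Real.sin_int_mul_pi]

theorem integrable_cos_mul (a : ℝ) : Integrable (fun x => Real.cos (a * x)) unitMeasure :=
  Integrable.of_bound (by fun_prop) 1 (Eventually.of_forall fun x => Real.abs_cos_le_one _)

theorem integral_cos_mul_cos (n m : ℕ) :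
    ∫ x, Real.cos (n * Real.pi * x) * Real.cos (m * Real.pi * x) ∂unitMeasure =
      if n = m then (if n = 0 then 1 else 1 / 2) else 0 := by
  have h : ∀ x : ℝ, Real.cos (n * Real.pi * x) * Real.cos (m * Real.pi * x) =
      (Real.cos (((n - m : ℤ) : ℝ) * Real.pi * x) +
        Real.cos (((n + m : ℤ) : ℝ) * Real.pi * x)) / 2 := by
    intro x
    push_cast
    rw [sub_mul, sub_mul, add_mul, add_mul, Real.cos_sub, Real.cos_add]
    ring
  simp_rw [h]
  rw [integral_div, integral_add (integrable_cos_mul _) (integrable_cos_mul _),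
    integral_cos_int_mul_pi, integral_cos_int_mul_pi]
  by_cases hnm : n = m
  · subst hnm
    by_cases hn : n = 0
    · simp [hn]
    · have : ¬ ((n : ℤ) + n = 0) := by omega
      simp [hn, this]
  · have h1 : ¬ ((n : ℤ) - m = 0) := by omega
    have h2 : ¬ ((n : ℤ) + m = 0) := by omega
    simp [hnm, h1, h2]

theorem orthonormal_cosFun : Orthonormal ℝ fun n => toL2 (cosFun n) := by
  rw [orthonormal_iff_ite]
  intro n m
  rw [L2.inner_def]
  have h : ∫ x, inner ℝ (toL2 (cosFun n) x) (toL2 (cosFun m) x) ∂unitMeasure =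
      ∫ x, (cosNorm n * cosNorm m) *
        (Real.cos (n * Real.pi * x) * Real.cos (m * Real.pi * x)) ∂unitMeasure := by
    refine integral_congr_ae ?_
    filter_upwards [coeFn_toL2 (cosFun n), coeFn_toL2 (cosFun m)] with x h1 h2
    rw [h1, h2, cosFun_apply, cosFun_apply, RCLike.inner_apply, conj_trivial]
    ring
  rw [h, integral_const_mul, integral_cos_mul_cos]
  by_cases hnm : n = m
  · subst hnm
    by_cases hn : n = 0
    · simp [hn, cosNorm]
    · simp [hn, cosNorm]
  · simp [hnm]

/-- A function that agrees with a polynomial in `cos(πx)` represents an element of the span of the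
cosines. -/
theorem exists_mem_span_cosFun (p : Polynomial ℝ) :
    ∃ g ∈ Submodule.span ℝ (Set.range fun n => toL2 (cosFun n)),
      g =ᵐ[unitMeasure] fun x => p.eval (Real.cos (Real.pi * x)) := by
  -- Carrying the extra factor cos(nπx) lets the induction on k absorb one cos(πx) at a time, by 2
  -- cos a cos b = cos(a+b) + cos(a-b); n = 0 is separate to avoid the index -1.
  have hcos : ∀ k n : ℕ, ∃ g ∈ Submodule.span ℝ (Set.range fun n => toL2 (cosFun n)),
      g =ᵐ[unitMeasure] fun x => Real.cos (Real.pi * x) ^ k * Real.cos (n * Real.pi * x) := by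
    intro k
    induction k with
    | zero =>
      intro n
      refine ⟨(cosNorm n)⁻¹ • toL2 (cosFun n),
        Submodule.smul_mem _ _ (Submodule.subset_span ⟨n, rfl⟩), ?_⟩
      filter_upwards [Lp.coeFn_smul (cosNorm n)⁻¹ (toL2 (cosFun n)), coeFn_toL2 (cosFun n)]
        with x h1 h2
      have := (cosNorm_pos n).ne'
      rw [h1, Pi.smul_apply, h2, cosFun_apply, smul_eq_mul]
      field_simp
    | succ k ih =>
      intro n
      rcases n with _ | n
      · obtain ⟨g, hg, h⟩ := ih 1
        refine ⟨g, hg, ?_⟩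
        filter_upwards [h] with x hx
        rw [hx]
        simp [pow_succ]
      · obtain ⟨g₁, hg₁, h₁⟩ := ih (n + 2)
        obtain ⟨g₂, hg₂, h₂⟩ := ih n
        refine ⟨(2⁻¹ : ℝ) • (g₁ + g₂), Submodule.smul_mem _ _ (Submodule.add_mem _ hg₁ hg₂), ?_⟩
        filter_upwards [h₁, h₂, Lp.coeFn_smul (2⁻¹ : ℝ) (g₁ + g₂), Lp.coeFn_add g₁ g₂]
          with x h1 h2 h3 h4
        rw [h3, Pi.smul_apply, h4, Pi.add_apply, h1, h2, smul_eq_mul]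
        have e1 : ((n + 2 : ℕ) : ℝ) * Real.pi * x =
            ((n + 1 : ℕ) : ℝ) * Real.pi * x + Real.pi * x := by push_cast; ring
        have e2 : (n : ℝ) * Real.pi * x =
            ((n + 1 : ℕ) : ℝ) * Real.pi * x - Real.pi * x := by push_cast; ring
        rw [e1, e2, Real.cos_add, Real.cos_sub]
        ring
  induction p using Polynomial.induction_on' with
  | add p q hp hq =>
    obtain ⟨g₁, hg₁, h₁⟩ := hp
    obtain ⟨g₂, hg₂, h₂⟩ := hq
    refine ⟨g₁ + g₂, Submodule.add_mem _ hg₁ hg₂, ?_⟩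
    filter_upwards [h₁, h₂, Lp.coeFn_add g₁ g₂] with x h1 h2 h3
    rw [h3, Pi.add_apply, h1, h2, Polynomial.eval_add]
  | monomial k a =>
    obtain ⟨g, hg, h⟩ := hcos k 0
    refine ⟨a • g, Submodule.smul_mem _ _ hg, ?_⟩
    filter_upwards [h, Lp.coeFn_smul a g] with x h1 h2
    rw [h2, Pi.smul_apply, h1]
    simp

/-- The substitution z = cos(πx) maps (0,1) into [-1,1], where Weierstrass approximates f(arccos
z/π) by polynomials. Uniform closeness bounds the L² distance, the measure being a probability, and
bounded continuous functions are dense in L². -/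
theorem span_cosFun_dense :
    ⊤ ≤ (Submodule.span ℝ (Set.range fun n => toL2 (cosFun n))).topologicalClosure := by
  set V := Submodule.span ℝ (Set.range fun n => toL2 (cosFun n)) with hV
  have hsub : Set.range toL2 ⊆ (V.topologicalClosure : Set L2) := by
    rintro _ ⟨f, rfl⟩
    rw [Submodule.topologicalClosure_coe, Metric.mem_closure_iff]
    intro ε hε
    obtain ⟨p, hp⟩ := exists_polynomial_near_of_continuousOn (-1) 1
      (fun z => f (Real.arccos z / Real.pi))
      (f.continuous.comp (Real.continuous_arccos.div_const _)).continuousOn (ε / 2) (half_pos hε)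
    obtain ⟨g, hg, h⟩ := exists_mem_span_cosFun p
    refine ⟨g, hg, ?_⟩
    rw [dist_eq_norm]
    have hb := Lp.norm_le_of_ae_bound (f := toL2 f - g) (C := ε / 2) (half_pos hε).le (by
      filter_upwards [h, coeFn_toL2 f, Lp.coeFn_sub (toL2 f) g,
        ae_restrict_mem measurableSet_Ioo] with x h1 h2 h3 hx
      rw [h3, Pi.sub_apply, h1, h2, norm_sub_rev]
      have h4 := hp (Real.cos (Real.pi * x)) ⟨Real.neg_one_le_cos _, Real.cos_le_one _⟩
      have hpi := Real.pi_pos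
      rw [Real.arccos_cos (by have := hx.1; positivity)
        (by nlinarith [hx.2]), mul_div_cancel_left₀ _ hpi.ne'] at h4
      exact h4.le)
    have h1 : measureUnivNNReal unitMeasure = 1 := by
      simp [measureUnivNNReal]
    rw [h1] at hb
    simp only [NNReal.coe_one, Real.one_rpow, one_mul] at hb
    linarith
  intro v _
  have hd : DenseRange toL2 :=
    BoundedContinuousFunction.toLp_denseRange ℝ unitMeasure ℝ (by norm_num)
  exact closure_minimal hsub V.isClosed_topologicalClosure (hd v)

/-- The Hilbert basis of normalized cosines. -/
noncomputable def cosBasis : HilbertBasis ℕ ℝ L2 :=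
  HilbertBasis.mk orthonormal_cosFun span_cosFun_dense

theorem cosBasis_apply (n : ℕ) : cosBasis n = toL2 (cosFun n) := by
  rw [cosBasis, HilbertBasis.coe_mk]

/-- Matches the expansion in √2 cos(nπx) with the orthonormal one; at n = 0 the factor 1/2 in
`cosCoeff` cancels √2·√2. -/
theorem cosCoeff_mul_sqrt_two (θ₀ : L2) (n : ℕ) :
    cosCoeff θ₀ n * Real.sqrt 2 = inner ℝ (cosBasis n) θ₀ * cosNorm n := by
  have h : inner ℝ (cosBasis n) θ₀ =
      cosNorm n * ∫ x, θ₀ x * Real.cos (n * Real.pi * x) ∂unitMeasure := by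
    rw [cosBasis_apply, L2.inner_def, ← integral_const_mul]
    refine integral_congr_ae ?_
    filter_upwards [coeFn_toL2 (cosFun n)] with x h1
    rw [h1, cosFun_apply, RCLike.inner_apply, conj_trivial]
    ring
  have h2 : ∫ x, θ₀ x * (Real.sqrt 2 * Real.cos (n * Real.pi * x)) ∂unitMeasure =
      Real.sqrt 2 * ∫ x, θ₀ x * Real.cos (n * Real.pi * x) ∂unitMeasure := by
    rw [← integral_const_mul]
    congr 1 with x
    ring
  rw [cosCoeff, h, h2]
  have h3 : Real.sqrt 2 * Real.sqrt 2 = 2 := Real.mul_self_sqrt (by norm_num)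
  unfold cosNorm
  split_ifs with hn
  · linear_combination (1 / 2 * ∫ x, θ₀ x * Real.cos (n * Real.pi * x) ∂unitMeasure) * h3
  · ring

/-- The free evolution at time `t > 0` as a bounded continuous function. -/
noncomputable def freeState (θ₀ : L2) (t : ℝ) : BoundedContinuousFunction ℝ ℝ :=
  ∑' n, (inner ℝ (cosBasis n) θ₀ * heatDecay t n) • cosFun n

/-- Convergence in sup norm allows both evaluation at a point and the inclusion in L² to be applied
termwise, so the same sum is known pointwise and by its Fourier coefficients. -/
theorem hasSum_freeState (θ₀ : L2) {t : ℝ} (ht : 0 < t) :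
    HasSum (fun n => (inner ℝ (cosBasis n) θ₀ * heatDecay t n) • cosFun n) (freeState θ₀ t) := by
  refine (Summable.of_norm_bounded ((summable_heatDecay ht).mul_left (2 * ‖θ₀‖))
    fun n => ?_).hasSum
  have h1 : |inner ℝ (cosBasis n) θ₀| ≤ ‖θ₀‖ := by
    have := abs_real_inner_le_norm (cosBasis n) θ₀
    rwa [cosBasis.orthonormal.1 n, one_mul] at this
  have h2 := (heatDecay_pos t n).le
  rw [norm_smul, norm_mul, Real.norm_eq_abs, Real.norm_of_nonneg h2]
  calc _ ≤ ‖θ₀‖ * heatDecay t n * 2 := by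
        gcongr
        exact norm_cosFun_le n
    _ = _ := by ring

theorem freeState_apply (θ₀ : L2) {t : ℝ} (ht : 0 < t) (x : ℝ) :
    freeState θ₀ t x = ∑' n : ℕ, cosCoeff θ₀ n * heatDecay t n *
      (Real.sqrt 2 * Real.cos (n * Real.pi * x)) := by
  have h := (hasSum_freeState θ₀ ht).mapL (BoundedContinuousFunction.evalCLM ℝ x)
  have h2 := h.tsum_eq
  simp only [BoundedContinuousFunction.evalCLM_apply] at h2
  rw [← h2]
  congr 1 with n
  rw [BoundedContinuousFunction.coe_smul]
  simp only [smul_eq_mul, cosFun_apply]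
  linear_combination (-heatDecay t n * Real.cos (n * Real.pi * x)) * cosCoeff_mul_sqrt_two θ₀ n

theorem inner_cosBasis_freeState (θ₀ : L2) {t : ℝ} (ht : 0 < t) (m : ℕ) :
    inner ℝ (cosBasis m) (toL2 (freeState θ₀ t)) =
      inner ℝ (cosBasis m) θ₀ * heatDecay t m := by
  have h := ((hasSum_freeState θ₀ ht).mapL toL2).mapL (innerSL ℝ (cosBasis m))
  simp only [map_smul, innerSL_apply_apply, ← cosBasis_apply] at h
  rw [← h.tsum_eq, tsum_eq_single m]
  · rw [real_inner_self_eq_norm_sq, cosBasis.orthonormal.1 m]; simp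
  · intro n hn
    rw [cosBasis.orthonormal.2 hn.symm]; simp

/-- By Parseval the squared distance is ∑ ⟨e_n, θ₀⟩² (1 - e^{-n²π²t})². Each term tends to 0 and is
dominated by ⟨e_n, θ₀⟩². -/
theorem tendsto_freeState (θ₀ : L2) :
    Tendsto (fun t => ‖toL2 (freeState θ₀ t) - θ₀‖) (𝓝[>] 0) (𝓝 0) := by
  have hsq : ∀ v : L2, ‖v‖ ^ 2 = ∑' n, inner ℝ (cosBasis n) v ^ 2 := by
    intro v
    rw [← real_inner_self_eq_norm_sq, ← cosBasis.tsum_inner_mul_inner v v]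
    congr 1 with n
    rw [real_inner_comm]; ring
  have hsum : Summable fun n => inner ℝ (cosBasis n) θ₀ ^ 2 := by
    refine (cosBasis.summable_inner_mul_inner θ₀ θ₀).congr fun n => ?_
    rw [real_inner_comm]; ring
  have hlim : Tendsto (fun t => ∑' n, (inner ℝ (cosBasis n) θ₀ * (heatDecay t n - 1)) ^ 2)
      (𝓝[>] 0) (𝓝 (∑' _ : ℕ, (0 : ℝ))) := by
    refine tendsto_tsum_of_dominated_convergence hsum (fun n => ?_) ?_
    · have hc : Continuous fun t => (inner ℝ (cosBasis n) θ₀ * (heatDecay t n - 1)) ^ 2 := by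
        unfold heatDecay; fun_prop
      have := hc.tendsto 0
      simp only [heatDecay, mul_zero, Real.exp_zero, sub_self, ne_eq, OfNat.ofNat_ne_zero,
        not_false_eq_true, zero_pow] at this
      exact this.mono_left nhdsWithin_le_nhds
    · filter_upwards [self_mem_nhdsWithin] with t ht n
      have h1 : heatDecay t n ≤ 1 := by
        have := heatDecay_anti (le_of_lt ht) n
        simpa [heatDecay] using this
      have h0 := (heatDecay_pos t n).le
      rw [norm_pow, norm_mul, mul_pow, Real.norm_eq_abs, sq_abs]
      refine mul_le_of_le_one_right (sq_nonneg _) ?_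
      rw [Real.norm_eq_abs, sq_abs]
      nlinarith
  rw [tsum_zero] at hlim
  have h2 : Tendsto (fun t => ‖toL2 (freeState θ₀ t) - θ₀‖ ^ 2) (𝓝[>] 0) (𝓝 0) := by
    refine hlim.congr' ?_
    filter_upwards [self_mem_nhdsWithin] with t ht
    rw [hsq]
    congr 1 with n
    rw [inner_sub_right, inner_cosBasis_freeState θ₀ ht]
    ring
  have h3 := (Real.continuous_sqrt.tendsto 0).comp h2
  rw [Real.sqrt_zero] at h3
  refine h3.congr fun t => ?_
  rw [Function.comp_apply, Real.sqrt_sq (norm_nonneg _)]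

theorem eLpNorm_freeState_sub (θ₀ : L2) (t : ℝ) :
    eLpNorm (fun x => freeState θ₀ t x - θ₀ x) 2 unitMeasure =
      ENNReal.ofReal ‖toL2 (freeState θ₀ t) - θ₀‖ := by
  rw [Lp.norm_def, ENNReal.ofReal_toReal (Lp.eLpNorm_ne_top _)]
  refine eLpNorm_congr_ae ?_
  filter_upwards [Lp.coeFn_sub (toL2 (freeState θ₀ t)) θ₀, coeFn_toL2 (freeState θ₀ t)]
    with x h1 h2
  rw [h1, Pi.sub_apply, h2]

/-! ### The controlled heat equation -/

theorem flatlyBounded_flatOutput {τ R' s : ℝ} (hs1 : 1 < s) (hs2 : s < 2) (hR : 0 < R')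
    (hRτ : R' < τ) (θ₀ : L2) : FlatlyBounded (flatOutput τ R' s θ₀) := by
  refine FlatlyBounded.of_gevrey hs2 (fun t ht => contDiffAt_flatOutput hs1 hs2 hR hRτ θ₀ ht)
    fun δ hδ => ?_
  obtain ⟨M, ρ, hM, hρ, h⟩ := exists_gevrey_flatOutput hs1 hs2 hR hRτ hδ
  exact ⟨M * ‖θ₀‖, ρ, by positivity, hρ, fun t ht n => h θ₀ t ht n⟩

/-- Up to time `τ`, the flat output is the one of the free evolution. -/
theorem iteratedDeriv_flatOutput_of_le {τ R' s : ℝ} (hs1 : 1 < s) (hs2 : s < 2) (hR : 0 < R')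
    (hRτ : R' < τ) (θ₀ : L2) (i : ℕ) {t : ℝ} (ht : 0 < t) (htτ : t ≤ τ) :
    iteratedDeriv i (flatOutput τ R' s θ₀) t = iteratedDeriv i (freeOutput θ₀) t := by
  have hlt : ∀ r, 0 < r → r < τ →
      iteratedDeriv i (flatOutput τ R' s θ₀) r = iteratedDeriv i (freeOutput θ₀) r := by
    intro r hr hrτ
    refine Filter.EventuallyEq.iteratedDeriv_eq i ?_
    filter_upwards [Ioo_mem_nhds hr hrτ] with x hx
    rw [flatOutput_eq hR hRτ θ₀ hx.1, stepFn_of_nonpos, one_mul]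
    exact div_nonpos_of_nonpos_of_nonneg (by linarith [hx.2]) hR.le
  rcases htτ.lt_or_eq with h | rfl
  · exact hlt t ht h
  -- At τ itself the two functions are known to agree only on the left, so their derivatives are
  -- compared through left limits.
  have h1 := (contDiffAt_iteratedDeriv (contDiffAt_flatOutput hs1 hs2 hR hRτ θ₀ ht)
    i).continuousAt.tendsto.mono_left (nhdsWithin_le_nhds (s := Set.Iio t))
  have h2 := (contDiffAt_iteratedDeriv (contDiffAt_freeOutput θ₀ ht)
    i).continuousAt.tendsto.mono_left (nhdsWithin_le_nhds (s := Set.Iio t))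
  refine tendsto_nhds_unique h1 (h2.congr' ?_)
  filter_upwards [Ioo_mem_nhdsLT ht] with r hr
  exact (hlt r hr.1 hr.2).symm

theorem tsum_flatTerm_of_le {τ R' s : ℝ} (hs1 : 1 < s) (hs2 : s < 2) (hR : 0 < R')
    (hRτ : R' < τ) (θ₀ : L2) {t : ℝ} (ht : 0 < t) (htτ : t ≤ τ) (x : ℝ) :
    ∑' i, flatTerm (flatOutput τ R' s θ₀) i t x = ∑' n : ℕ, cosCoeff θ₀ n * heatDecay t n *
        (Real.sqrt 2 * Real.cos (n * Real.pi * x)) := by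
  rw [← (hasSum_freeOutput_cos θ₀ ht x).tsum_eq]
  congr 1 with i
  rw [flatTerm, iteratedDeriv_flatOutput_of_le hs1 hs2 hR hRτ θ₀ i ht htτ]

theorem theta_eq_tsum_flatTerm {τ R' s : ℝ} (hs1 : 1 < s) (hs2 : s < 2) (hR : 0 < R')
    (hRτ : R' < τ) (θ₀ : L2) {t : ℝ} (ht : 0 < t) (x : ℝ) :
    theta τ R' s θ₀ t x = ∑' i, flatTerm (flatOutput τ R' s θ₀) i t x := by
  rw [theta]
  split_ifs with h
  · rw [tsum_flatTerm_of_le hs1 hs2 hR hRτ θ₀ ht h.le]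
    rfl
  · rfl

/-- After τ this is the definition of the control. Up to τ the sum is a cosine series, symmetric
about x = 1, so its derivative there equals its own opposite; convergence on |x| < 2 makes this a
two-sided derivative. -/
theorem tsum_flatTermX_one {τ R' s : ℝ} (hs1 : 1 < s) (hs2 : s < 2) (hR : 0 < R')
    (hRτ : R' < τ) (θ₀ : L2) {t : ℝ} (ht : 0 < t) :
    ∑' i, flatTermX (flatOutput τ R' s θ₀) i t 1 = control τ R' s θ₀ t := by
  rw [control]
  split_ifs with h
  · have hy := flatlyBounded_flatOutput hs1 hs2 hR hRτ θ₀
    have h1 := hy.hasDerivAt_tsum_flatTerm (x := 1) ht (by norm_num)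
    have h2 : HasDerivAt (fun x => ∑' i, flatTerm (flatOutput τ R' s θ₀) i t (2 - x))
        (-∑' i, flatTermX (flatOutput τ R' s θ₀) i t 1) 1 := by
      have h3 : HasDerivAt (fun x => ∑' i, flatTerm (flatOutput τ R' s θ₀) i t x)
          (∑' i, flatTermX (flatOutput τ R' s θ₀) i t 1) (2 - 1) := by
        rwa [show (2 : ℝ) - 1 = 1 by norm_num]
      exact h3.comp_const_sub 2 1
    have h4 : (fun x => ∑' i, flatTerm (flatOutput τ R' s θ₀) i t (2 - x)) =
        fun x => ∑' i, flatTerm (flatOutput τ R' s θ₀) i t x := by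
      funext x
      rw [tsum_flatTerm_of_le hs1 hs2 hR hRτ θ₀ ht h, tsum_flatTerm_of_le hs1 hs2 hR hRτ θ₀ ht h]
      congr 1 with n
      rw [show (n : ℝ) * Real.pi * (2 - x) = n * (2 * Real.pi) - n * Real.pi * x by ring,
        Real.cos_nat_mul_two_pi_sub]
    rw [h4] at h2
    have := h1.unique h2
    linarith
  · congr 1 with i
    simp [flatTermX]

theorem isHeatSolution_theta {T τ R' s : ℝ} (hs1 : 1 < s) (hs2 : s < 2) (hR : 0 < R')
    (hRτ : R' < τ) (θ₀ : L2) :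
    IsHeatSolution T θ₀ (control τ R' s θ₀) (theta τ R' s θ₀) := by
  set y := flatOutput τ R' s θ₀ with hyd
  have hy : FlatlyBounded y := flatlyBounded_flatOutput hs1 hs2 hR hRτ θ₀
  have heq : ∀ t, 0 < t → theta τ R' s θ₀ t = fun x => ∑' i, flatTerm y i t x :=
    fun t ht => funext fun x => theta_eq_tsum_flatTerm hs1 hs2 hR hRτ θ₀ ht x
  have habs : ∀ x ∈ Set.Icc (0 : ℝ) 1, |x| < 2 := fun x hx => by
    rw [abs_of_nonneg hx.1]; linarith [hx.2]
  refine ⟨⟨fun t x => ∑' i, flatTermX y i t x, fun t x => ∑' i, flatTermT y i t x,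
    ?_, ?_, ?_, fun t ht => ⟨fun x hx => ⟨?_, ?_, ?_⟩, ?_, ?_⟩⟩, ?_⟩
  · refine (continuousOn_tsum_of_flat hy (f := flatTerm y)
      (fun i t x ht => continuousAt_iteratedDeriv_mul_pow hy i _ _ ht)
      (fun i t x hx => Or.inl (abs_flatTerm_le y hx i)) T).congr ?_
    rintro ⟨t, x⟩ ⟨ht, -⟩
    exact congrFun (heq t ht.1) x
  · exact continuousOn_tsum_of_flat hy (f := flatTermX y)
      (fun i t x ht => continuousAt_iteratedDeriv_mul_pow hy (i + 1) _ _ ht)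
      (fun i t x hx => Or.inr (abs_flatTermX_le y hx i)) T
  · exact continuousOn_tsum_of_flat hy (f := flatTermT y)
      (fun i t x ht => continuousAt_iteratedDeriv_mul_pow hy (i + 1) _ _ ht)
      (fun i t x hx => Or.inr (abs_flatTermT_le y hx i)) T
  · rw [heq t ht.1]
    exact (hy.hasDerivAt_tsum_flatTerm ht.1 (habs x hx)).hasDerivWithinAt
  · exact (hy.hasDerivAt_tsum_flatTermX ht.1 (habs x hx)).hasDerivWithinAt
  · exact (hy.hasDerivAt_time ht.1 (habs x hx).le).hasDerivWithinAt.congr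
      (fun r hr => congrFun (heq r hr.1) x) (congrFun (heq t ht.1) x)
  · simp [flatTermX]
  · exact tsum_flatTermX_one hs1 hs2 hR hRτ θ₀ ht.1
  · have h := (ENNReal.continuous_ofReal.tendsto 0).comp (tendsto_freeState θ₀)
    rw [ENNReal.ofReal_zero] at h
    refine h.congr' ?_
    -- Only 0 < t < τ matters in the limit, and there θ is the cosine series by definition.
    filter_upwards [Ioo_mem_nhdsGT (hR.trans hRτ)] with t ht
    rw [Function.comp_apply, ← eLpNorm_freeState_sub]
    congr 1 with x
    rw [freeState_apply θ₀ ht.1, theta, if_pos ht.2]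
    rfl

theorem seriesConverge_flatOutput {T τ R' s : ℝ} (hs1 : 1 < s) (hs2 : s < 2) (hR : 0 < R')
    (hRτ : R' < τ) (θ₀ : L2) : SeriesConverge T τ R' s θ₀ := by
  have hτ : 0 < τ := hR.trans hRτ
  have hy := flatlyBounded_flatOutput hs1 hs2 hR hRτ θ₀
  refine ⟨summable_yTerm θ₀ hτ, fun t ht => ?_, fun t ht => hy.smooth t (hτ.trans_le ht.1),
    fun t ht => ?_, fun t ht x hx => ?_⟩
  · refine (hasSum_freeOutput_taylor θ₀ ?_).2.summable
    exact abs_lt.2 ⟨by linarith [ht.1], by linarith [ht.2]⟩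
  · simpa [flatTermX] using hy.summable_flatTermX (x := 1) (hτ.trans_le ht.1) (by norm_num)
  · exact hy.summable_flatTerm (hτ.trans_le ht.1) (by rw [abs_of_nonneg hx.1]; linarith [hx.2])

/-! ### The truncation error -/

theorem abs_flatTerm_le_gevreyWeight {d x M ρ s : ℝ} {i : ℕ} (hM : 0 ≤ M) (hρ : 0 < ρ)
    (hd : |d| ≤ M * ρ ^ i * (i.factorial : ℝ) ^ s) (hx : |x| ≤ 1) :
    |d * x ^ (2 * i) / ((2 * i).factorial : ℝ)| ≤ M * gevreyWeight s ρ i := by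
  rw [abs_div, abs_mul, abs_pow, Nat.abs_cast, gevreyWeight, ← mul_div_assoc, ← mul_assoc]
  refine div_le_div_of_nonneg_right ?_ (Nat.cast_nonneg _)
  calc |d| * |x| ^ (2 * i) ≤ M * ρ ^ i * (i.factorial : ℝ) ^ s * 1 :=
        mul_le_mul hd (pow_le_one₀ (abs_nonneg x) hx) (by positivity) (by positivity)
    _ = _ := mul_one _

/-- The error is the tail i > I of the exact series plus the terms i ≤ I built on the error of the
flat output. The latter are bounded by the full sum of Gevrey weights, hence uniformly in I. -/
theorem exists_truncation_bound {τ R' s : ℝ} (hs1 : 1 < s) (hs2 : s < 2) (hR : 0 < R')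
    (hRτ : R' < τ) : ∃ C C₁ C₂ C₃ : ℝ, 0 < C ∧ 0 < C₁ ∧ 0 < C₂ ∧ 0 < C₃ ∧
      ∀ (θ₀ : L2) (I K N : ℕ) (t x : ℝ), τ ≤ t → |x| ≤ 1 →
        |theta τ R' s θ₀ t x - thetaBar τ R' s θ₀ I K N t x| ≤
          C * (Real.exp (-C₁ * (I * Real.log I)) + Real.exp (-C₂ * K) +
            Real.exp (-C₃ * (N : ℝ) ^ 2)) * ‖θ₀‖ := by
  have hτ : 0 < τ := hR.trans hRτ
  obtain ⟨M₁, ρ₁, hM₁, hρ₁, h₁⟩ := exists_gevrey_flatOutput hs1 hs2 hR hRτ hτ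
  obtain ⟨M₂, ρ₂, C₂, C₃, hM₂, hρ₂, hC₂, hC₃, h₂⟩ :=
    exists_gevrey_flatOutput_sub hs1 hs2 hR hRτ
  obtain ⟨D, hD, hDt⟩ := exists_tail_gevreyWeight hs2 hρ₁
  set W := ∑' i, gevreyWeight s ρ₂ i with hW
  have hW0 : 0 ≤ W := tsum_nonneg fun i => gevreyWeight_nonneg hρ₂ i
  -- The summand 1 only ensures C > 0, since M₁ and M₂ are merely nonnegative.
  refine ⟨M₁ * D + M₂ * W + 1, (2 - s) / 2, C₂, C₃, by positivity, by linarith, hC₂, hC₃,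
    fun θ₀ I K N t x ht hx => ?_⟩
  have ht0 : 0 < t := hτ.trans_le ht
  have hy := flatlyBounded_flatOutput hs1 hs2 hR hRτ θ₀
  set y := flatOutput τ R' s θ₀ with hyd
  set a := Real.exp (-((2 - s) / 2) * (I * Real.log I)) with ha
  set b := Real.exp (-C₂ * K) + Real.exp (-C₃ * (N : ℝ) ^ 2) with hb
  have ha0 : 0 < a := Real.exp_pos _
  have hb0 : 0 < b := by positivity
  have hsplit : theta τ R' s θ₀ t x - thetaBar τ R' s θ₀ I K N t x =
      ∑ i ∈ Finset.range (I + 1), (iteratedDeriv i y t -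
        iteratedDeriv i (flatOutputBar τ R' s θ₀ K N) t) * x ^ (2 * i) /
          ((2 * i).factorial : ℝ) + ∑' i, flatTerm y (i + (I + 1)) t x := by
    rw [theta_eq_tsum_flatTerm hs1 hs2 hR hRτ θ₀ ht0,
      ← (hy.summable_flatTerm ht0 (by linarith : |x| ≤ 2)).sum_add_tsum_nat_add (I + 1),
      add_sub_right_comm, thetaBar, ← Finset.sum_sub_distrib]
    congr 1
    refine Finset.sum_congr rfl fun i _ => ?_
    rw [flatTerm]
    ring
  have htail : |∑' i, flatTerm y (i + (I + 1)) t x| ≤ M₁ * ‖θ₀‖ * (D * a) := by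
    have hinj : Function.Injective fun i : ℕ => i + (I + 1) := add_left_injective _
    have hs := ((summable_gevreyWeight hs2 hρ₁).comp_injective hinj).hasSum.mul_left (M₁ * ‖θ₀‖)
    rw [← Real.norm_eq_abs]
    refine (tsum_of_norm_bounded hs fun i => ?_).trans ?_
    · exact abs_flatTerm_le_gevreyWeight (by positivity) hρ₁ (h₁ θ₀ t ht _) hx
    · exact mul_le_mul_of_nonneg_left (hDt I) (by positivity)
  have hhead : |∑ i ∈ Finset.range (I + 1), (iteratedDeriv i y t -
        iteratedDeriv i (flatOutputBar τ R' s θ₀ K N) t) * x ^ (2 * i) /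
          ((2 * i).factorial : ℝ)| ≤ M₂ * b * ‖θ₀‖ * W := by
    refine (Finset.abs_sum_le_sum_abs _ _).trans ((Finset.sum_le_sum fun i _ =>
      abs_flatTerm_le_gevreyWeight (by positivity) hρ₂ (h₂ θ₀ K N t ht i) hx).trans ?_)
    rw [← Finset.mul_sum]
    refine mul_le_mul_of_nonneg_left ?_ (by positivity)
    exact (summable_gevreyWeight hs2 hρ₂).sum_le_tsum _ fun i _ => gevreyWeight_nonneg hρ₂ i
  rw [hsplit, add_assoc a]
  refine ((abs_add_le _ _).trans (add_le_add hhead htail)).trans ?_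
  calc M₂ * b * ‖θ₀‖ * W + M₁ * ‖θ₀‖ * (D * a) = (M₂ * W * b + M₁ * D * a) * ‖θ₀‖ := by ring
    _ ≤ ((M₁ * D + M₂ * W + 1) * (a + b)) * ‖θ₀‖ := by
      gcongr
      have e1 : 0 ≤ M₂ * W * a := by positivity
      have e2 : 0 ≤ M₁ * D * b := by positivity
      nlinarith

end FlatHeat

theorem theorem2 (T τ s R' : ℝ) (hτ : 0 < τ) (hτT : τ < T) (hs1 : 1 < s) (hs2 : s < 2)
    (hR'0 : 0 < R') (hR'τ : R' < τ) (hR'T : R' ≤ T - τ) :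
    (∀ θ₀ : FlatHeat.L2,
      FlatHeat.SeriesConverge T τ R' s θ₀ ∧
      FlatHeat.IsHeatSolution T θ₀ (FlatHeat.control τ R' s θ₀) (FlatHeat.theta τ R' s θ₀)) ∧
    ∃ C C₁ C₂ C₃ : ℝ, 0 < C ∧ 0 < C₁ ∧ 0 < C₂ ∧ 0 < C₃ ∧
      ∀ (θ₀ : FlatHeat.L2) (I K N : ℕ), ∀ t ∈ Set.Icc τ T,
        eLpNorm (fun x => FlatHeat.theta τ R' s θ₀ t x - FlatHeat.thetaBar τ R' s θ₀ I K N t x)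
            ⊤ FlatHeat.unitMeasure ≤
          ENNReal.ofReal (C *
            (Real.exp (-C₁ * (I * Real.log I)) + Real.exp (-C₂ * K) +
              Real.exp (-C₃ * (N : ℝ) ^ 2)) * ‖θ₀‖) := by
  refine ⟨fun θ₀ => ⟨FlatHeat.seriesConverge_flatOutput hs1 hs2 hR'0 hR'τ θ₀,
    FlatHeat.isHeatSolution_theta hs1 hs2 hR'0 hR'τ θ₀⟩, ?_⟩
  obtain ⟨C, C₁, C₂, C₃, hC, hC₁, hC₂, hC₃, h⟩ :=
    FlatHeat.exists_truncation_bound hs1 hs2 hR'0 hR'τ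
  refine ⟨C, C₁, C₂, C₃, hC, hC₁, hC₂, hC₃, fun θ₀ I K N t ht => ?_⟩
  rw [eLpNorm_exponent_top]
  refine eLpNormEssSup_le_of_ae_bound ?_
  filter_upwards [ae_restrict_mem measurableSet_Ioo] with x hx
  refine h θ₀ I K N t x ht.1 ?_
  rw [abs_of_pos hx.1]
  exact hx.2.le
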